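/- Let $R$ be a commutative ring, $F$ a free $R$-module with basis $f_1,\dots,f_n$, and $\psi:F\to R$ an $R$-linear map such that $\psi(f_1),\dots,\psi(f_n)$ is a regular sequence. Assume either (1) $R$ is a Noetherian local ring with maximal ideal $\mathfrak m$, or (2) $R=\bigoplus_{i\ge 0}R_i$ is a non-negatively graded ring and each $\psi(f_i)$ is homogeneous of positive degree, in which case put $\mathfrak m=\bigoplus_{i>0}R_i$. Let $w\in\mathbb N^n$ be any vector and $d\ge 1$ an integer. Give $f_\sigma\otimes f^\alpha=(f_{\sigma_1}\wedge\cdots\wedge f_{\sigma_a})\otimes f_1^{\alpha_1}\cdots f_n^{\alpha_n}\in\bigwedge^aF\otimes S_b(F)$ (with $\sigma_1<\cdots<\sigma_a$ and $|\alpha|=b$) the multidegree $\epsilon_{\sigma_1}+\cdots+\epsilon_{\sigma_a}+\alpha\in\mathbb N^n$, and let $(\bigwedge^aF\otimes S_b(F))_w$ be the free submodule spanned by those $f_\sigma\otimes f^\alpha$ whose multidegree is componentwise at most $w$; for $a=0$ write $(S_b)_w$. Let $L^a_{b,w}$ be the kernel of the tautological Koszul map $$\kappa:\Big(\bigwedge^aF\otimes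 S_b(F)\Big)_w\to\Big(\bigwedge^{a-1}F\otimes S_{b+1}(F)\Big)_w,\qquad f_\sigma\otimes f^\alpha\mapsto\sum_j(-1)^{j-1}f_{\sigma\smallsetminus\sigma_j}\otimes f_{\sigma_j}f^\alpha,$$ so that $L^0_{d,w}=(S_d)_w$. Let $\mathrm{Kos}:\bigwedge^aF\to\bigwedge^{a-1}F$ be the Koszul differential of $\psi$; the maps $\mathrm{Kos}\otimes 1$ send $L^{a}_{d,w}$ into $L^{a-1}_{d,w}$. Let $(\operatorname{im}\psi)^d_w$ be the ideal generated by the products $\psi(f_1)^{\alpha_1}\cdots\psi(f_n)^{\alpha_n}$ with $\alpha\le w$ and $|\alpha|=d$, and let $\psi:(S_d)_w\to R$ also denote the map $f^\alpha\mapsto\psi(f_1)^{\alpha_1}\cdots\psi(f_n)^{\alpha_n}$. Then $L^a_{d,w}=0$ for $a\ge n$, and the complex $$L^w(\psi,d):\quad 0\to L^{n-1}_{d,w}\xrightarrow{\mathrm{Kos}\otimes 1}\cdots\xrightarrow{\mathrm{Kos}\otimes 1}L^1_{d,w}\xrightarrow{\mathrm{Kos}\otimes 1}(S_d)_w\xrightarrow{\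 \psi\ }R$$ is the minimal free resolution of $R/(\operatorname{im}\psi)^d_w$: all its terms are finitely generated free $R$-modules, it is exact except at $R$, where the cokernel is $R/(\operatorname{im}\psi)^d_w$, and each differential has image in $\mathfrak m$ times its target. In case (2) it is moreover a graded resolution: its terms have bases whose elements can be assigned degrees so that all the differentials, and the surjection $R\to R/(\operatorname{im}\psi)^d_w$, are homogeneous of degree $0$. -/

import Mathlib

open scoped TensorProduct

universe u

namespace LComplex

/-- The `w`-restricted `d`th power of the ideal generated by `x 1, …, x n`: the ideal generated by
the monomials `∏ (x i) ^ (α i)` with `α ≤ w` and `|α| = d`. -/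
def restrictedPower {R : Type u} [CommRing R] {n : ℕ} (x : Fin n → R) (w : Fin n → ℕ) (d : ℕ) :
    Ideal R :=
  Ideal.span {y | ∃ α : Fin n → ℕ, α ≤ w ∧ ∑ i, α i = d ∧ y = ∏ i, x i ^ α i}

noncomputable section

variable {R : Type u} [CommRing R] {F : Type u} [AddCommGroup F] [Module R F] {n : ℕ}

/-- The differential of the Koszul complex of `ψ : F → R`, on the whole exterior algebra:
`v₁ ∧ ⋯ ∧ vₐ ↦ ∑ⱼ (-1)^(j-1) ψ(vⱼ) v₁ ∧ ⋯ v̂ⱼ ⋯ ∧ vₐ` (see `kos_ιMulti`), that is, the contraction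
with `ψ`. -/
def kos (ψ : F →ₗ[R] R) : ExteriorAlgebra R F →ₗ[R] ExteriorAlgebra R F :=
  CliffordAlgebra.contractLeft (Q := (0 : QuadraticForm R F)) ψ

theorem kos_ι_mul (ψ : F →ₗ[R] R) (v : F) (x : ExteriorAlgebra R F) :
    kos ψ (ExteriorAlgebra.ι R v * x) = ψ v • x - ExteriorAlgebra.ι R v * kos ψ x :=
  CliffordAlgebra.contractLeft_ι_mul (Q := (0 : QuadraticForm R F)) ψ v x

theorem kos_one (ψ : F →ₗ[R] R) : kos ψ 1 = 0 :=
  CliffordAlgebra.contractLeft_one (Q := (0 : QuadraticForm R F)) ψ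

theorem kos_comm (ψ φ : F →ₗ[R] R) (x : ExteriorAlgebra R F) :
    kos ψ (kos φ x) = -kos φ (kos ψ x) :=
  CliffordAlgebra.contractLeft_comm (Q := (0 : QuadraticForm R F)) ψ φ x

theorem kos_ιMulti (ψ : F →ₗ[R] R) (a : ℕ) (v : Fin (a + 1) → F) :
    kos ψ (ExteriorAlgebra.ιMulti R (a + 1) v) =
      ∑ j : Fin (a + 1), ((-1 : R) ^ (j : ℕ) * ψ (v j)) •
        ExteriorAlgebra.ιMulti R a (fun k => v (j.succAbove k)) := by
  induction a with
  | zero =>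
    rw [ExteriorAlgebra.ιMulti_succ_apply, kos_ι_mul]
    simp [kos_one]
  | succ a ih =>
    rw [ExteriorAlgebra.ιMulti_succ_apply, kos_ι_mul, ih, Finset.mul_sum, sub_eq_add_neg,
      ← Finset.sum_neg_distrib]
    conv_rhs => rw [Fin.sum_univ_succ]
    congr 1
    · simp [Matrix.vecTail, Function.comp_def]
    · refine Finset.sum_congr rfl fun j _ => ?_
      rw [ExteriorAlgebra.ιMulti_succ_apply, mul_smul_comm, ← neg_smul]
      congr 1
      · simp [Matrix.vecTail, pow_succ]
      · simp [Matrix.vecTail, Function.comp_def]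

/-- The component `⋀ᵃ F → ⋀ᵃ⁻¹ F ⊗ F` of the comultiplication of the exterior algebra (all `a` at
once), `v₁ ∧ ⋯ ∧ vₐ ↦ ∑ⱼ (-1)^(j-1) (v₁ ∧ ⋯ v̂ⱼ ⋯ ∧ vₐ) ⊗ vⱼ`, written in terms of the basis `f`,
where contracting with the dual basis vector `fᵢ*` removes `fᵢ`. -/
def comult (f : Module.Basis (Fin n) R F) :
    ExteriorAlgebra R F →ₗ[R] ExteriorAlgebra R F ⊗[R] F :=
  ∑ i, ((TensorProduct.mk R (ExteriorAlgebra R F) F).flip (f i)) ∘ₗ kos (f.coord i)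

/-- The tautological Koszul differential `κ : ⋀ᵃ F ⊗ S_b F → ⋀ᵃ⁻¹ F ⊗ S_{b+1} F` (all `a` and `b` at
once): comultiply in the exterior algebra, then multiply in the symmetric algebra. -/
def kappa (f : Module.Basis (Fin n) R F) :
    ExteriorAlgebra R F ⊗[R] SymmetricAlgebra R F →ₗ[R]
      ExteriorAlgebra R F ⊗[R] SymmetricAlgebra R F :=
  TensorProduct.map LinearMap.id
      (LinearMap.mul' R (SymmetricAlgebra R F) ∘ₗ
        TensorProduct.map (SymmetricAlgebra.ι R F) LinearMap.id) ∘ₗ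
    (TensorProduct.assoc R (ExteriorAlgebra R F) F (SymmetricAlgebra R F)).toLinearMap ∘ₗ
    TensorProduct.map (comult f) LinearMap.id

theorem kappa_tmul (f : Module.Basis (Fin n) R F) (x : ExteriorAlgebra R F)
    (s : SymmetricAlgebra R F) :
    kappa f (x ⊗ₜ s) = ∑ i, kos (f.coord i) x ⊗ₜ (SymmetricAlgebra.ι R F (f i) * s) := by
  simp [kappa, comult, TensorProduct.sum_tmul]

/-- `Kos ⊗ 1` on `⋀ F ⊗ S F`. -/
def kosTensor (ψ : F →ₗ[R] R) :
    ExteriorAlgebra R F ⊗[R] SymmetricAlgebra R F →ₗ[R]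
      ExteriorAlgebra R F ⊗[R] SymmetricAlgebra R F :=
  TensorProduct.map (kos ψ) LinearMap.id

theorem kappa_kosTensor (f : Module.Basis (Fin n) R F) (ψ : F →ₗ[R] R)
    (z : ExteriorAlgebra R F ⊗[R] SymmetricAlgebra R F) :
    kappa f (kosTensor ψ z) = -kosTensor ψ (kappa f z) := by
  induction z with
  | zero => simp
  | add x y hx hy => rw [map_add, map_add, hx, hy, map_add, map_add, neg_add]
  | tmul x s =>
    simp only [kosTensor, TensorProduct.map_tmul, LinearMap.id_apply, kappa_tmul, map_sum]
    rw [← Finset.sum_neg_distrib]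
    refine Finset.sum_congr rfl fun i _ => ?_
    rw [kos_comm, TensorProduct.neg_tmul]

/-- `f_σ = f_{σ₁} ∧ ⋯ ∧ f_{σₐ}`, for `σ₁ < ⋯ < σₐ`. -/
def wedge (f : Module.Basis (Fin n) R F) {a : ℕ} (σ : Fin a ↪o Fin n) : ExteriorAlgebra R F :=
  ExteriorAlgebra.ιMulti R a (fun j => f (σ j))

/-- `f^α = f₁^{α₁} ⋯ fₙ^{αₙ}` in the symmetric algebra. -/
def monomial (f : Module.Basis (Fin n) R F) (α : Fin n → ℕ) : SymmetricAlgebra R F :=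
  ∏ i, SymmetricAlgebra.ι R F (f i) ^ α i

/-- The multidegree `ε_{σ₁} + ⋯ + ε_{σₐ} + α` of `f_σ ⊗ f^α`. -/
def mdeg {a : ℕ} (σ : Fin a ↪o Fin n) (α : Fin n → ℕ) : Fin n → ℕ :=
  ∑ j, Pi.single (σ j) 1 + α

/-- `(⋀ᵃ F ⊗ S_b F)_w`: the free submodule of `⋀ F ⊗ S F` spanned by the `f_σ ⊗ f^α` with
`|σ| = a`, `|α| = b` and multidegree at most `w`. -/
def restricted (f : Module.Basis (Fin n) R F) (w : Fin n → ℕ) (a b : ℕ) :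
    Submodule R (ExteriorAlgebra R F ⊗[R] SymmetricAlgebra R F) :=
  Submodule.span R {z | ∃ (σ : Fin a ↪o Fin n) (α : Fin n → ℕ),
    ∑ i, α i = b ∧ mdeg σ α ≤ w ∧ z = wedge f σ ⊗ₜ[R] monomial f α}

/-- `Lᵃ_{b,w}(F)`: the kernel of the tautological Koszul map `κ` on `(⋀ᵃ F ⊗ S_b F)_w`. -/
def L (f : Module.Basis (Fin n) R F) (w : Fin n → ℕ) (a b : ℕ) :
    Submodule R (ExteriorAlgebra R F ⊗[R] SymmetricAlgebra R F) :=
  restricted f w a b ⊓ LinearMap.ker (kappa f)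

/-- `L⁰_{d,w}` is `(S_d)_w`, identified with `(⋀⁰ ⊗ S_d)_w`. -/
theorem L_zero (f : Module.Basis (Fin n) R F) (w : Fin n → ℕ) (b : ℕ) :
    L f w 0 b = restricted f w 0 b := by
  refine inf_eq_left.2 (Submodule.span_le.2 ?_)
  rintro _ ⟨σ, α, -, -, rfl⟩
  simp [kappa_tmul, wedge, ExteriorAlgebra.ιMulti_zero_apply, kos_one]

theorem kosTensor_mem_restricted (f : Module.Basis (Fin n) R F) (ψ : F →ₗ[R] R) (w : Fin n → ℕ)
    (a b : ℕ) {z : ExteriorAlgebra R F ⊗[R] SymmetricAlgebra R F}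
    (hz : z ∈ restricted f w (a + 1) b) : kosTensor ψ z ∈ restricted f w a b := by
  refine (Submodule.span_le.2 ?_ :
    restricted f w (a + 1) b ≤ (restricted f w a b).comap (kosTensor ψ)) hz
  rintro _ ⟨σ, α, hα, hw, rfl⟩
  simp only [Submodule.comap_coe, Set.mem_preimage, SetLike.mem_coe, kosTensor,
    TensorProduct.map_tmul, wedge, kos_ιMulti, LinearMap.id_apply, TensorProduct.sum_tmul]
  refine Submodule.sum_mem _ fun j _ => ?_
  rw [← TensorProduct.smul_tmul']
  refine Submodule.smul_mem _ _ (Submodule.subset_span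
    ⟨(Fin.succAboveOrderEmb j).trans σ, α, hα, le_trans ?_ hw, rfl⟩)
  intro i
  simp only [mdeg, Pi.add_apply, Finset.sum_apply]
  rw [Fin.sum_univ_succAbove _ j]
  simp only [RelEmbedding.coe_trans, Function.comp_apply, Fin.succAboveOrderEmb_apply]
  omega

theorem kosTensor_mem_L (f : Module.Basis (Fin n) R F) (ψ : F →ₗ[R] R) (w : Fin n → ℕ)
    (a b : ℕ) {z : ExteriorAlgebra R F ⊗[R] SymmetricAlgebra R F}
    (hz : z ∈ L f w (a + 1) b) : kosTensor ψ z ∈ L f w a b := by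
  refine ⟨kosTensor_mem_restricted f ψ w a b hz.1, ?_⟩
  have h : kappa f z = 0 := hz.2
  simp [kappa_kosTensor, h]

/-- The map `⋀ F ⊗ S F → R` that sends `1 ⊗ f^α` to `ψ(f₁)^{α₁} ⋯ ψ(fₙ)^{αₙ}` and kills `⋀ᵃ F ⊗ S F`
for `a > 0`; on `⋀⁰ F ⊗ S_d F = S_d F` it is the map `S_d(ψ)`. -/
def symEval (ψ : F →ₗ[R] R) : ExteriorAlgebra R F ⊗[R] SymmetricAlgebra R F →ₗ[R] R :=
  LinearMap.mul' R R ∘ₗ TensorProduct.map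
    (ExteriorAlgebra.algebraMapInv (R := R) (M := F)).toLinearMap
    (SymmetricAlgebra.lift ψ).toLinearMap

/-- The terms of the complex `L^w(ψ, d)`: `R` in degree `0` and `Lᵃ_{d,w}` in degree `a + 1`. -/
def Term (f : Module.Basis (Fin n) R F) (w : Fin n → ℕ) (d : ℕ) : ℕ → Type u
  | 0 => R
  | a + 1 => L f w a d

instance instAddCommGroupTerm (f : Module.Basis (Fin n) R F) (w : Fin n → ℕ) (d : ℕ) :
    ∀ i, AddCommGroup (Term f w d i)
  | 0 => inferInstanceAs (AddCommGroup R)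
  | a + 1 => inferInstanceAs (AddCommGroup (L f w a d))

instance instModuleTerm (f : Module.Basis (Fin n) R F) (w : Fin n → ℕ) (d : ℕ) :
    ∀ i, Module R (Term f w d i)
  | 0 => inferInstanceAs (Module R R)
  | a + 1 => inferInstanceAs (Module R (L f w a d))

/-- The differentials of `L^w(ψ, d)`: `ψ : (S_d)_w → R`, and `Kos ⊗ 1 : Lᵃ⁺¹_{d,w} → Lᵃ_{d,w}`. -/
def diff (f : Module.Basis (Fin n) R F) (ψ : F →ₗ[R] R) (w : Fin n → ℕ) (d : ℕ) :
    ∀ i, Term f w d (i + 1) →ₗ[R] Term f w d i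
  | 0 => (symEval ψ).domRestrict (L f w 0 d)
  | a + 1 => (kosTensor ψ).restrict (p := L f w (a + 1) d) (q := L f w a d)
      fun _ hz => kosTensor_mem_L f ψ w a d hz

end

/-- `⋯ → X 1 → X 0 → M → 0` is a resolution of `M` by finitely generated free modules that is
minimal with respect to the ideal `m`: each differential `X (i + 1) → X i` has image in `m (X i)`. -/
structure IsMinimalFreeResolution {R : Type u} [CommRing R] (m : Ideal R) {X : ℕ → Type u}
    [∀ i, AddCommGroup (X i)] [∀ i, Module R (X i)] (δ : ∀ i, X (i + 1) →ₗ[R] X i)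
    {M : Type u} [AddCommGroup M] [Module R M] (π : X 0 →ₗ[R] M) : Prop where
  free : ∀ i, Module.Free R (X i)
  finite : ∀ i, Module.Finite R (X i)
  exact : ∀ i, Function.Exact (δ (i + 1)) (δ i)
  exact_zero : Function.Exact (δ 0) π
  surjective : Function.Surjective π
  minimal : ∀ i, LinearMap.range (δ i) ≤ m • (⊤ : Submodule R (X i))

/-- Over a ring `R` graded by `𝒜`, the complex `⋯ → X 1 → X 0 → R/J → 0` of finitely generated free
modules is a complex of graded free modules and maps of degree `0`: the `X i` have finite bases whose
members can be assigned degrees such that the matrices of the differentials have homogeneous entries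
of the right degrees, and `π` sends a basis element of degree `e` to the class of an element
of `𝒜 e`. -/
def IsGradedComplex {R : Type u} [CommRing R] (𝒜 : ℤ → AddSubgroup R)
    {X : ℕ → Type u} [∀ i, AddCommGroup (X i)] [∀ i, Module R (X i)]
    (δ : ∀ i, X (i + 1) →ₗ[R] X i) {J : Ideal R} (π : X 0 →ₗ[R] R ⧸ J) : Prop :=
  ∃ (r : ℕ → ℕ) (b : ∀ i, Module.Basis (Fin (r i)) R (X i)) (e : ∀ i, Fin (r i) → ℤ),
    (∀ i j k, (b i).repr (δ i (b (i + 1) j)) k ∈ 𝒜 (e (i + 1) j - e i k)) ∧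
    ∀ k, ∃ x ∈ 𝒜 (e 0 k), π (b 0 k) = Ideal.Quotient.mk J x

end LComplex

namespace LComplex

noncomputable section

variable {R : Type u} [CommRing R] {F : Type u} [AddCommGroup F] [Module R F] {n : ℕ}

/-! The modules `(⋀ᵃ F ⊗ S_b F)_w` carry two anticommuting differentials, `κ` and `Kos ⊗ 1`, and the
proof is a diagram chase between them.

The `κ` direction needs no hypothesis on `ψ`. Moving the smallest index that occurs in `f_s ⊗ f^α`
from the symmetric to the exterior factor is a contracting homotopy `h` away from multidegree 0. It
preserves multidegrees, hence the bound `w`. So `κ h` is a projection onto `Lᵃ_{b,w}` for `b ≥ 1`,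
which gives the vanishing of `Lᵃ` for `a ≥ n` and explicit, homogeneous bases.

In the `Kos` direction the complex splits over the monomials `f^α`: the coefficient of `f^α` lies in
the exterior algebra on the `f_i` with `α_i < w_i`. Hence the rows are exact in positive exterior
degree once the Koszul complex of every subfamily of the `ψ(f_i)` is exact there
(`exists_kosTensor_eq`). For the full family this follows from regularity. It passes to subfamilies
by Nakayama in the local case and by induction on the degree in the graded case.

Exactness of `L^w(ψ, d)` is then an induction on `d`. Write a cycle `z` as `κ y` with `y = h z`.
Then `Kos y` is a cycle for `d - 1`, so `Kos y = Kos y'` with `κ y' = 0`. Row exactness gives `y -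
y' = Kos u`, so `z = κ Kos u = Kos (-κ u)`. Minimality holds because `Kos ⊗ 1` is the combination,
with coefficients `ψ(f_i)`, of contractions that themselves preserve the family `Lᵃ`. -/

theorem kos_kos (ψ : F →ₗ[R] R) (x : ExteriorAlgebra R F) : kos ψ (kos ψ x) = 0 :=
  CliffordAlgebra.contractLeft_contractLeft (Q := (0 : QuadraticForm R F)) ψ x

theorem kos_eq_sum (f : Module.Basis (Fin n) R F) (ψ : F →ₗ[R] R) (x : ExteriorAlgebra R F) :
    kos ψ x = ∑ i, ψ (f i) • kos (f.coord i) x := by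
  have h : ψ = ∑ i, ψ (f i) • f.coord i := by
    refine f.ext fun j => ?_
    simp
  have h2 := congrArg (fun φ : Module.Dual R F =>
    CliffordAlgebra.contractLeft (Q := (0 : QuadraticForm R F)) φ x) h
  simp only [map_sum, map_smul, LinearMap.sum_apply, LinearMap.smul_apply] at h2
  exact h2

/-! ### The standard basis of the exterior algebra and contraction in coordinates -/

theorem wedge_eq_basis (f : Module.Basis (Fin n) R F) {a : ℕ} (σ : Fin a ↪o Fin n)
    {s : Finset (Fin n)} (hs : Finset.univ.map σ.toEmbedding = s) :
    wedge f σ = f.ExteriorAlgebra s := by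
  have hc : s.card = a := by simp [← hs]
  rw [ExteriorAlgebra.basis_apply_ofCard f hc, wedge, ExteriorAlgebra.ιMulti_family]
  congr 1
  ext j
  simp only [Function.comp_apply, Set.powersetCard.ofFinEmbEquiv_symm_apply]
  congr 1
  have := Finset.orderEmbOfFin_unique' (s := s) hc (f := σ) (fun x => by simp [← hs])
  exact congrArg (fun g : Fin a ↪o Fin n => g j) this

theorem extBasis_empty (f : Module.Basis (Fin n) R F) : f.ExteriorAlgebra ∅ = 1 := by
  rw [ExteriorAlgebra.basis_apply_ofCard f Finset.card_empty, ExteriorAlgebra.ιMulti_family]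
  simp [ExteriorAlgebra.ιMulti_zero_apply]

/-- Prepending an index below all others keeps the wedge increasing, so no sign appears. This drives
the induction on the minimum in `kos_extBasis`. -/
theorem ι_mul_extBasis (f : Module.Basis (Fin n) R F) {v : Fin n} {s : Finset (Fin n)}
    (h : ∀ j ∈ s, v < j) :
    ExteriorAlgebra.ι R (f v) * f.ExteriorAlgebra s = f.ExteriorAlgebra (insert v s) := by
  have hv : v ∉ s := fun hv => lt_irrefl _ (h v hv)
  have hmono : StrictMono (Fin.cons v (s.orderEmbOfFin rfl) : Fin (s.card + 1) → Fin n) := by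
    intro i j hij
    induction i using Fin.cases with
    | zero =>
      induction j using Fin.cases with
      | zero => exact absurd hij (lt_irrefl _)
      | succ j => simpa using h _ (Finset.orderEmbOfFin_mem s rfl j)
    | succ i =>
      induction j using Fin.cases with
      | zero => exact absurd hij (Fin.not_lt_zero _)
      | succ j => simpa using hij
  have e1 : wedge f (s.orderEmbOfFin rfl) = f.ExteriorAlgebra s :=
    wedge_eq_basis f _ (Finset.map_orderEmbOfFin_univ s rfl)
  have e2 : wedge f (OrderEmbedding.ofStrictMono _ hmono) = f.ExteriorAlgebra (insert v s) := by
    refine wedge_eq_basis f _ ?_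
    ext x
    simp only [Finset.mem_map, Finset.mem_univ, true_and, Finset.mem_insert, Fin.exists_fin_succ]
    have : (∃ i, s.orderEmbOfFin rfl i = x) ↔ x ∈ s := by
      rw [← Set.mem_range, Finset.range_orderEmbOfFin, Finset.mem_coe]
    simp [← this, eq_comm]
  rw [← e1, ← e2, wedge, wedge, ExteriorAlgebra.ιMulti_succ_apply]
  simp [Matrix.vecTail, Function.comp_def]

/-- The sign `(-1)^#{j ∈ s | j < i}` of `i` relative to `s`. -/
def sgn (R : Type u) [CommRing R] {n : ℕ} (i : Fin n) (s : Finset (Fin n)) : R :=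
  (-1) ^ (s.filter (· < i)).card

theorem kos_extBasis (f : Module.Basis (Fin n) R F) (φ : F →ₗ[R] R) (s : Finset (Fin n)) :
    kos φ (f.ExteriorAlgebra s) =
      ∑ i ∈ s, (sgn R i s * φ (f i)) • f.ExteriorAlgebra (s.erase i) := by
  induction s using Finset.induction_on_min with
  | empty => simp [extBasis_empty, kos_one]
  | insert v s h ih =>
    have hv : v ∉ s := fun hv => lt_irrefl _ (h v hv)
    rw [← ι_mul_extBasis f h, kos_ι_mul, ih, Finset.sum_insert hv, Finset.erase_insert hv,
      sub_eq_add_neg, Finset.mul_sum, ← Finset.sum_neg_distrib]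
    congr 1
    · have : (insert v s).filter (· < v) = ∅ := by
        ext x; simp only [Finset.mem_filter, Finset.mem_insert, Finset.notMem_empty, iff_false]
        rintro ⟨rfl | hx, hlt⟩
        · exact lt_irrefl _ hlt
        · exact lt_asymm (h _ hx) hlt
      simp [sgn, this]
    · refine Finset.sum_congr rfl fun i hi => ?_
      have hne : v ≠ i := fun e => hv (e ▸ hi)
      rw [mul_smul_comm, ι_mul_extBasis f (fun j hj => h j (Finset.mem_of_mem_erase hj)),
        Finset.erase_insert_of_ne hne, ← neg_smul]
      congr 1
      -- The new minimum `v` lies below `i`, which flips the sign of `i` and absorbs the minus sign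
      -- of the Leibniz rule.
      rw [sgn, sgn, Finset.filter_insert, if_pos (h i hi), Finset.card_insert_of_notMem
        (by simp [hv]), pow_succ]
      ring

theorem extBasis_repr_kos (f : Module.Basis (Fin n) R F) (φ : F →ₗ[R] R)
    (x : ExteriorAlgebra R F) (t : Finset (Fin n)) :
    f.ExteriorAlgebra.repr (kos φ x) t = ∑ i ∈ tᶜ, sgn R i (insert i t) * φ (f i) *
      f.ExteriorAlgebra.repr x (insert i t) := by
  have key : f.ExteriorAlgebra.coord t ∘ₗ kos φ = ∑ i ∈ tᶜ, (sgn R i (insert i t) * φ (f i)) •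
      f.ExteriorAlgebra.coord (insert i t) := by
    refine f.ExteriorAlgebra.ext fun s => ?_
    rw [LinearMap.comp_apply, kos_extBasis]
    simp only [map_sum, map_smul, Module.Basis.coord_apply, Module.Basis.repr_self,
      LinearMap.sum_apply, LinearMap.smul_apply, smul_eq_mul, Finsupp.single_apply]
    simp only [mul_ite, mul_one, mul_zero, ← Finset.sum_filter]
    have hset : s.filter (fun i => s.erase i = t) = tᶜ.filter (fun i => s = insert i t) := by
      ext i
      simp only [Finset.mem_filter, Finset.mem_compl]
      constructor
      · rintro ⟨hi, rfl⟩
        exact ⟨by simp, (Finset.insert_erase hi).symm⟩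
      · rintro ⟨hi, rfl⟩
        exact ⟨by simp, Finset.erase_insert hi⟩
    rw [hset]
    refine Finset.sum_congr rfl fun i hi => ?_
    rw [← (Finset.mem_filter.1 hi).2]
  simpa using LinearMap.congr_fun key x

/-! ### Exterior powers, and exterior algebras on subsets of the basis -/

theorem mem_exteriorPower_iff (f : Module.Basis (Fin n) R F) (a : ℕ) (x : ExteriorAlgebra R F) :
    x ∈ ⋀[R]^a F ↔ ∀ s, f.ExteriorAlgebra.repr x s ≠ 0 → s.card = a := by
  have h : (⋀[R]^a F) = Submodule.span R (f.ExteriorAlgebra '' {s | s.card = a}) := by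
    apply le_antisymm
    · intro x hx
      rw [← Submodule.coe_mk x hx, ← (f.exteriorPower a).sum_repr ⟨x, hx⟩]
      rw [AddSubmonoidClass.coe_finsetSum]
      refine Submodule.sum_mem _ fun s _ => ?_
      rw [Submodule.coe_smul, ← ExteriorAlgebra.basis_eq_coe_basis]
      exact Submodule.smul_mem _ _ (Submodule.subset_span ⟨s, s.2, rfl⟩)
    · rw [Submodule.span_le]
      rintro _ ⟨s, hs, rfl⟩
      have := ExteriorAlgebra.basis_eq_coe_basis f (⟨s, hs⟩ : Set.powersetCard (Fin n) a)
      rw [SetLike.mem_coe]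
      exact this ▸ (f.exteriorPower a ⟨s, hs⟩).2
  rw [h, Module.Basis.mem_span_image]
  simp [Set.subset_def]

theorem kos_mem_exteriorPower (ψ : F →ₗ[R] R) {a : ℕ} {x : ExteriorAlgebra R F}
    (hx : x ∈ ⋀[R]^(a + 1) F) : kos ψ x ∈ ⋀[R]^a F := by
  rw [← ExteriorAlgebra.ιMulti_span_fixedDegree] at hx
  refine (Submodule.span_le.2 ?_ : _ ≤ (⋀[R]^a F).comap (kos ψ)) hx
  rintro _ ⟨v, rfl⟩
  rw [SetLike.mem_coe, Submodule.mem_comap, kos_ιMulti]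
  exact Submodule.sum_mem _ fun j _ => Submodule.smul_mem _ _
    (ExteriorAlgebra.ιMulti_range R a ⟨_, rfl⟩)

theorem ι_mul_mem_exteriorPower (v : F) {a : ℕ} {x : ExteriorAlgebra R F} (hx : x ∈ ⋀[R]^a F) :
    ExteriorAlgebra.ι R v * x ∈ ⋀[R]^(a + 1) F := by
  rw [ExteriorAlgebra.exteriorPower, pow_succ']
  exact Submodule.mul_mem_mul ⟨v, rfl⟩ hx

/-- The degree `a` part of the exterior algebra of the span of the `f i`, `i ∈ T`. -/
def extSub (f : Module.Basis (Fin n) R F) (T : Finset (Fin n)) (a : ℕ) :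
    Submodule R (ExteriorAlgebra R F) :=
  (⋀[R]^a F) ⊓ ⨅ i ∈ Tᶜ, LinearMap.ker (kos (f.coord i))

theorem mem_extSub (f : Module.Basis (Fin n) R F) {T : Finset (Fin n)} {a : ℕ}
    {x : ExteriorAlgebra R F} :
    x ∈ extSub f T a ↔ x ∈ ⋀[R]^a F ∧ ∀ i ∉ T, kos (f.coord i) x = 0 := by
  simp [extSub]

/-- Up to sign, contraction with `fᵢ*` reads off exactly the coordinates at the sets that contain
`i`. The contraction form of `extSub` suits calculations with `kos`, the coordinate form suits
degree projections and slices. -/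
theorem mem_extSub_iff_repr (f : Module.Basis (Fin n) R F) {T : Finset (Fin n)} {a : ℕ}
    {x : ExteriorAlgebra R F} :
    x ∈ extSub f T a ↔ ∀ s, f.ExteriorAlgebra.repr x s ≠ 0 → s ⊆ T ∧ s.card = a := by
  have hcoord : ∀ i s, f.ExteriorAlgebra.repr (kos (f.coord i) x) s =
      if i ∈ s then 0 else sgn R i (insert i s) * f.ExteriorAlgebra.repr x (insert i s) := by
    intro i s
    rw [extBasis_repr_kos]
    by_cases hi : i ∈ s
    · rw [if_pos hi]
      refine Finset.sum_eq_zero fun j hj => ?_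
      have : j ≠ i := fun e => (Finset.mem_compl.1 hj) (e ▸ hi)
      simp [this]
    · rw [if_neg hi, Finset.sum_eq_single i]
      · simp
      · intro j _ hj
        simp [hj]
      · simp [hi]
  rw [mem_extSub, mem_exteriorPower_iff f]
  constructor
  · rintro ⟨h1, h2⟩ s hs
    refine ⟨fun i hi => ?_, h1 s hs⟩
    by_contra hT
    have := hcoord i (s.erase i)
    rw [h2 i hT, if_neg (by simp), Finset.insert_erase hi] at this
    simp only [map_zero, Finsupp.coe_zero, Pi.zero_apply, sgn] at this
    refine hs ?_
    have h3 := congrArg (fun y => (-1 : R) ^ (s.filter (· < i)).card * y) this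
    simpa [← mul_assoc, ← pow_add, ← two_mul, pow_mul] using h3.symm
  · intro h
    refine ⟨fun s hs => (h s hs).2, fun i hi => ?_⟩
    refine f.ExteriorAlgebra.repr.injective (Finsupp.ext fun s => ?_)
    rw [hcoord]
    split_ifs with his
    · simp
    · have : f.ExteriorAlgebra.repr x (insert i s) = 0 := by
        by_contra hne
        exact hi ((h _ hne).1 (by simp))
      simp [this]

theorem extSub_mono (f : Module.Basis (Fin n) R F) {T T' : Finset (Fin n)} (h : T ⊆ T') (a : ℕ) :
    extSub f T a ≤ extSub f T' a := fun x hx => by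
  rw [mem_extSub] at hx ⊢
  exact ⟨hx.1, fun i hi => hx.2 i fun hT => hi (h hT)⟩

theorem contract_mem_extSub (f : Module.Basis (Fin n) R F) {T : Finset (Fin n)} {t : Fin n} {a : ℕ}
    {x : ExteriorAlgebra R F} (hx : x ∈ extSub f (insert t T) (a + 1)) :
    kos (f.coord t) x ∈ extSub f T a := by
  rw [mem_extSub] at hx ⊢
  refine ⟨kos_mem_exteriorPower _ hx.1, fun i hi => ?_⟩
  by_cases hit : i = t
  · rw [hit, kos_kos]
  · rw [kos_comm, hx.2 i (by simp [hi, hit]), map_zero, neg_zero]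

theorem ι_mul_mem_extSub (f : Module.Basis (Fin n) R F) {T : Finset (Fin n)} (t : Fin n) {a : ℕ}
    {x : ExteriorAlgebra R F} (hx : x ∈ extSub f T a) :
    ExteriorAlgebra.ι R (f t) * x ∈ extSub f (insert t T) (a + 1) := by
  rw [mem_extSub] at hx ⊢
  refine ⟨ι_mul_mem_exteriorPower _ hx.1, fun i hi => ?_⟩
  simp only [Finset.mem_insert, not_or] at hi
  rw [kos_ι_mul, hx.2 i hi.2]
  simp [Ne.symm hi.1]

/-- This gives the decomposition `x = x₀ + f_t ∧ x₁` with `x₁` the contraction of `x` by `f_t*` and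
neither part involving `f_t`. -/
theorem sub_ι_mul_contract_mem_extSub (f : Module.Basis (Fin n) R F) {T : Finset (Fin n)}
    {t : Fin n} {a : ℕ} {x : ExteriorAlgebra R F} (hx : x ∈ extSub f (insert t T) (a + 1)) :
    x - ExteriorAlgebra.ι R (f t) * kos (f.coord t) x ∈ extSub f T (a + 1) := by
  have h := (extSub f (insert t T) (a + 1)).sub_mem hx
    (ι_mul_mem_extSub f t (contract_mem_extSub f hx))
  rw [mem_extSub] at h ⊢
  refine ⟨h.1, fun i hi => ?_⟩
  by_cases hit : i = t
  · rw [hit, map_sub, kos_ι_mul, kos_kos]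
    simp
  · exact h.2 i (by simp [hi, hit])

/-! ### Exactness of Koszul complexes on subfamilies -/

theorem kos_ι (ψ : F →ₗ[R] R) (v : F) :
    kos ψ (ExteriorAlgebra.ι R v) = algebraMap R _ (ψ v) := by
  rw [← mul_one (ExteriorAlgebra.ι R v), kos_ι_mul, kos_one, mul_zero, sub_zero,
    Algebra.algebraMap_eq_smul_one]

/-- The image of `kos ψ` on the degree one part of the exterior algebra of the span of the `f i`,
`i ∈ T`, is the ideal generated by the `ψ (f i)`. -/
theorem exists_kos_eq_algebraMap_iff (f : Module.Basis (Fin n) R F) (ψ : F →ₗ[R] R)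
    (T : Finset (Fin n)) (c : R) :
    (∃ v ∈ extSub f T 1, kos ψ v = algebraMap R _ c) ↔
      c ∈ Ideal.span ((fun i => ψ (f i)) '' (T : Set (Fin n))) := by
  constructor
  · rintro ⟨x, hx, hxc⟩
    obtain ⟨hx1, hx2⟩ := mem_extSub f |>.1 hx
    rw [ExteriorAlgebra.exteriorPower, pow_one] at hx1
    obtain ⟨v, rfl⟩ := hx1
    simp only [kos_ι, ExteriorAlgebra.algebraMap_inj, ExteriorAlgebra.algebraMap_eq_zero_iff]
      at hxc hx2
    rw [← hxc, ← f.sum_repr v, map_sum]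
    refine Ideal.sum_mem _ fun i _ => ?_
    rw [map_smul, smul_eq_mul]
    by_cases hi : i ∈ T
    · exact Ideal.mul_mem_left _ _ (Ideal.subset_span ⟨i, hi, rfl⟩)
    · rw [← f.coord_apply, hx2 i hi, zero_mul]
      exact zero_mem _
  · intro hc
    refine Submodule.span_induction ?_ ?_ ?_ ?_ hc
    · rintro _ ⟨i, hi, rfl⟩
      refine ⟨ExteriorAlgebra.ι R (f i), mem_extSub f |>.2 ⟨?_, fun j hj => ?_⟩, kos_ι _ _⟩
      · rw [ExteriorAlgebra.exteriorPower, pow_one]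
        exact ⟨_, rfl⟩
      · have : i ≠ j := fun e => hj (e ▸ hi)
        simp [kos_ι, this]
    · exact ⟨0, zero_mem _, by simp⟩
    · rintro x y _ _ ⟨v, hv, hvx⟩ ⟨u, hu, huy⟩
      exact ⟨v + u, add_mem hv hu, by rw [map_add, map_add, hvx, huy]⟩
    · rintro r x _ ⟨v, hv, hvx⟩
      exact ⟨r • v, Submodule.smul_mem _ _ hv, by
        rw [map_smul, hvx, smul_eq_mul, map_mul, Algebra.smul_def]⟩

/-- The Koszul complex of the `ψ (f i)`, `i ∈ T`, is exact in positive degrees. -/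
def KoszulExact (f : Module.Basis (Fin n) R F) (ψ : F →ₗ[R] R) (T : Finset (Fin n)) : Prop :=
  ∀ a, ∀ x ∈ extSub f T (a + 1), kos ψ x = 0 → ∃ y ∈ extSub f T (a + 2), kos ψ y = x

theorem KoszulExact.empty (f : Module.Basis (Fin n) R F) (ψ : F →ₗ[R] R) : KoszulExact f ψ ∅ := by
  intro a x hx _
  refine ⟨0, zero_mem _, ?_⟩
  rw [map_zero, eq_comm]
  refine f.ExteriorAlgebra.repr.injective (Finsupp.ext fun s => ?_)
  by_contra hs
  obtain ⟨h1, h2⟩ := mem_extSub_iff_repr f |>.1 hx s (by simpa using hs)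
  simp [Finset.subset_empty.1 h1] at h2

/-- The Koszul complex on `insert t T` is the mapping cone of multiplication by `ψ (f t)` on the one
on `T`. For a cycle `x₀ + f_t ∧ x₁`, the part `x₁` is a cycle and `Kos x₀ = -ψ(f_t) x₁`. It suffices
that `x₁` bounds, and regularity is needed only when `x₁` has exterior degree 0. -/
theorem KoszulExact.insert_of_regular {f : Module.Basis (Fin n) R F} {ψ : F →ₗ[R] R} {T : Finset (Fin n)}
    (h : KoszulExact f ψ T) {t : Fin n}
    (hreg : ∀ c, ψ (f t) * c ∈ Ideal.span ((fun i => ψ (f i)) '' (T : Set (Fin n))) →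
      c ∈ Ideal.span ((fun i => ψ (f i)) '' (T : Set (Fin n)))) :
    KoszulExact f ψ (insert t T) := by
  intro a x hx hx0
  set x1 := kos (f.coord t) x with hx1
  set x0 := x - ExteriorAlgebra.ι R (f t) * x1 with hx0'
  have m1 : x1 ∈ extSub f T a := contract_mem_extSub f hx
  have m0 : x0 ∈ extSub f T (a + 1) := sub_ι_mul_contract_mem_extSub f hx
  have c1 : kos ψ x1 = 0 := by rw [hx1, kos_comm, hx0, map_zero, neg_zero]
  have c0 : kos ψ x0 = -(ψ (f t) • x1) := by
    rw [hx0', map_sub, hx0, kos_ι_mul, c1]; simp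
  obtain ⟨v, hv, hvx⟩ : ∃ v ∈ extSub f T (a + 1), kos ψ v = x1 := by
    rcases a with _ | a
    · obtain ⟨c, hc⟩ : ∃ c, algebraMap R _ c = x1 := by
        have := (mem_extSub f |>.1 m1).1
        rwa [ExteriorAlgebra.exteriorPower, pow_zero, Submodule.mem_one] at this
      obtain ⟨v, hv, hvc⟩ := (exists_kos_eq_algebraMap_iff f ψ T c).2 <| hreg c <|
        (exists_kos_eq_algebraMap_iff f ψ T _).1 ⟨-x0, neg_mem m0, by
          rw [map_neg, c0, neg_neg, map_mul, hc, Algebra.smul_def]⟩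
      exact ⟨v, hv, hvc.trans hc⟩
    · exact h a x1 m1 c1
  obtain ⟨y, hy, hyx⟩ := h a (x0 + ψ (f t) • v)
    (add_mem m0 (Submodule.smul_mem _ _ hv)) (by rw [map_add, map_smul, hvx, c0]; simp)
  refine ⟨y - ExteriorAlgebra.ι R (f t) * v, sub_mem (extSub_mono f (Finset.subset_insert _ _) _ hy)
    (ι_mul_mem_extSub f t hv), ?_⟩
  rw [map_sub, hyx, kos_ι_mul, hvx, hx0']
  abel

/-- Cycles on `T` are boundaries on `T` up to `ψ (f t)` times cycles on `T`. -/
theorem KoszulExact.exists_of_insert {f : Module.Basis (Fin n) R F} {ψ : F →ₗ[R] R}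
    {T : Finset (Fin n)} {t : Fin n} (h : KoszulExact f ψ (insert t T)) (ht : t ∉ T) {a : ℕ}
    {x : ExteriorAlgebra R F} (hx : x ∈ extSub f T (a + 1)) (hx0 : kos ψ x = 0) :
    ∃ y ∈ extSub f T (a + 2), ∃ z ∈ extSub f T (a + 1), kos ψ z = 0 ∧
      x = kos ψ y + ψ (f t) • z := by
  obtain ⟨u, hu, hux⟩ := h a x (extSub_mono f (Finset.subset_insert _ _) _ hx) hx0
  -- Since `x` does not involve `f_t`, the `f_t`-part of the element `u` bounding it is itself a
  -- cycle.
  have hz : kos ψ (kos (f.coord t) u) = 0 := by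
    rw [kos_comm, hux, (mem_extSub f |>.1 hx).2 t ht, neg_zero]
  refine ⟨u - ExteriorAlgebra.ι R (f t) * kos (f.coord t) u, sub_ι_mul_contract_mem_extSub f hu,
    kos (f.coord t) u, contract_mem_extSub f hu, hz, ?_⟩
  rw [map_sub, kos_ι_mul, hz, hux]
  simp

/-- By `exists_of_insert`, cycles are contained in boundaries plus the maximal ideal times cycles.
The cycles are finitely generated over the Noetherian ring, so Nakayama applies. -/
theorem KoszulExact.of_insert_of_isLocalRing [IsNoetherianRing R] [IsLocalRing R]
    {f : Module.Basis (Fin n) R F} {ψ : F →ₗ[R] R} {T : Finset (Fin n)} {t : Fin n}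
    (h : KoszulExact f ψ (insert t T)) (ht : t ∉ T)
    (hm : ψ (f t) ∈ IsLocalRing.maximalIdeal R) : KoszulExact f ψ T := by
  intro a x hx hx0
  have : Module.Finite R (ExteriorAlgebra R F) := Module.Finite.of_basis f.ExteriorAlgebra
  have key : extSub f T (a + 1) ⊓ LinearMap.ker (kos ψ) ≤ (extSub f T (a + 2)).map (kos ψ) := by
    refine Submodule.le_of_le_smul_of_le_jacobson_bot (IsNoetherian.noetherian _)
      (IsLocalRing.maximalIdeal_le_jacobson _) ?_
    rintro z ⟨hz, hz0⟩
    obtain ⟨y, hy, u, hu, hu0, rfl⟩ := h.exists_of_insert ht hz hz0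
    exact Submodule.add_mem_sup ⟨y, hy, rfl⟩ (Submodule.smul_mem_smul hm ⟨hu, hu0⟩)
  exact key ⟨hx, hx0⟩

theorem KoszulExact.univ_of_isWeaklyRegular (f : Module.Basis (Fin n) R F) (ψ : F →ₗ[R] R)
    (hreg : RingTheory.Sequence.IsWeaklyRegular R (List.ofFn fun i => ψ (f i))) :
    KoszulExact f ψ Finset.univ := by
  -- Induction over initial segments: `ψ(f_k)` is a nonzerodivisor modulo the ideal of the preceding
  -- values.
  have key : ∀ k ≤ n, KoszulExact f ψ (Finset.univ.filter fun i : Fin n => (i : ℕ) < k) := by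
    intro k
    induction k with
    | zero => intro _; simpa using KoszulExact.empty f ψ
    | succ k ih =>
      intro hk
      have hset : (Finset.univ.filter fun i : Fin n => (i : ℕ) < k + 1) =
          insert ⟨k, hk⟩ (Finset.univ.filter fun i : Fin n => (i : ℕ) < k) := by
        ext i
        simp only [Finset.mem_filter, Finset.mem_univ, true_and, Finset.mem_insert, Fin.ext_iff]
        omega
      rw [hset]
      refine (ih (by omega)).insert_of_regular fun c hc => ?_
      have hr := hreg.regular_mod_prev k (by simpa using hk)
      have hI : Ideal.ofList ((List.ofFn fun i => ψ (f i)).take k) =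
          Ideal.span ((fun i => ψ (f i)) ''
            ((Finset.univ.filter fun i : Fin n => (i : ℕ) < k : Finset (Fin n)) : Set (Fin n))) := by
        rw [Ideal.ofList]
        congr 1
        ext y
        simp only [Set.mem_ofPred_eq, List.mem_take_iff_getElem, List.length_ofFn,
          List.getElem_ofFn, Set.mem_image, Finset.coe_filter, Finset.mem_univ, true_and]
        constructor
        · rintro ⟨j, hj, rfl⟩
          exact ⟨⟨j, by omega⟩, by simp; omega, rfl⟩
        · rintro ⟨j, hj, rfl⟩
          exact ⟨j, by omega, rfl⟩
      rw [hI, smul_eq_mul, Ideal.mul_top, List.getElem_ofFn] at hr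
      rw [← Ideal.Quotient.eq_zero_iff_mem] at hc ⊢
      refine hr ?_
      simp only [smul_zero]
      exact hc
  have := key n le_rfl
  rwa [Finset.filter_true_of_mem (fun i _ => i.2)] at this

/-- Every subset is reached from the full index set by deleting one index at a time. -/
theorem KoszulExact.of_univ {f : Module.Basis (Fin n) R F} {ψ : F →ₗ[R] R}
    (h : KoszulExact f ψ Finset.univ)
    (hdesc : ∀ t T, t ∉ T → KoszulExact f ψ (insert t T) → KoszulExact f ψ T)
    (T : Finset (Fin n)) : KoszulExact f ψ T := by
  obtain ⟨U, rfl⟩ : ∃ U, T = Uᶜ := ⟨Tᶜ, by simp⟩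
  induction U using Finset.induction_on with
  | empty => simpa using h
  | insert t U ht ih =>
    refine hdesc t _ (by simp) ?_
    rwa [Finset.compl_insert, Finset.insert_erase (by simpa using ht)]

/-! ### Descent to subfamilies in the graded case -/

section Graded

theorem sgn_mul_mem (𝒜 : ℤ → AddSubgroup R) (k : ℤ) {a : R} (ha : a ∈ 𝒜 k) (i : Fin n) (s : Finset (Fin n)) :
    sgn R i s * a ∈ 𝒜 k := by
  rw [sgn]
  rcases neg_one_pow_eq_or R (s.filter (· < i)).card with h | h <;> rw [h]
  · simpa using ha
  · simpa using ha

variable (𝒜 : ℤ → AddSubgroup R) [GradedRing 𝒜]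

/-- The component of degree `k` of an element of the exterior algebra, where `f i` has degree
`e i`. -/
def extProj (f : Module.Basis (Fin n) R F) (e : Fin n → ℤ) (k : ℤ) (x : ExteriorAlgebra R F) :
    ExteriorAlgebra R F :=
  ∑ s, (GradedRing.proj 𝒜 (k - ∑ i ∈ s, e i) (f.ExteriorAlgebra.repr x s)) • f.ExteriorAlgebra s

theorem repr_extProj (f : Module.Basis (Fin n) R F) (e : Fin n → ℤ) (k : ℤ)
    (x : ExteriorAlgebra R F) (s : Finset (Fin n)) :
    f.ExteriorAlgebra.repr (extProj 𝒜 f e k x) s =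
      GradedRing.proj 𝒜 (k - ∑ i ∈ s, e i) (f.ExteriorAlgebra.repr x s) := by
  rw [extProj, Module.Basis.repr_sum_self]

theorem proj_mul_of_mem {k : ℤ} {a : R} (ha : a ∈ 𝒜 k) (j : ℤ) (b : R) :
    GradedRing.proj 𝒜 j (a * b) = a * GradedRing.proj 𝒜 (j - k) b := by
  obtain ⟨i, rfl⟩ : ∃ i, j = k + i := ⟨j - k, by ring⟩
  rw [add_sub_cancel_left, GradedRing.proj_apply,
    DirectSum.coe_decompose_mul_add_of_left_mem 𝒜 ha, GradedRing.proj_apply]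

variable {𝒜} {f : Module.Basis (Fin n) R F} {ψ : F →ₗ[R] R} {e : Fin n → ℤ}

/-- Giving `f i` the degree of `ψ (f i)` makes the Koszul differential homogeneous of degree 0. -/
theorem kos_extProj (he : ∀ i, ψ (f i) ∈ 𝒜 (e i)) (k : ℤ) (x : ExteriorAlgebra R F) :
    kos ψ (extProj 𝒜 f e k x) = extProj 𝒜 f e k (kos ψ x) := by
  refine f.ExteriorAlgebra.repr.injective (Finsupp.ext fun s => ?_)
  rw [extBasis_repr_kos, repr_extProj, extBasis_repr_kos, map_sum]
  refine Finset.sum_congr rfl fun i hi => ?_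
  rw [repr_extProj, proj_mul_of_mem 𝒜 (sgn_mul_mem 𝒜 _ (he i) i _),
    Finset.sum_insert (Finset.mem_compl.1 hi)]
  congr 3
  ring

theorem extProj_smul (k j : ℤ) {a : R} (ha : a ∈ 𝒜 j) (x : ExteriorAlgebra R F) :
    extProj 𝒜 f e k (a • x) = a • extProj 𝒜 f e (k - j) x := by
  refine f.ExteriorAlgebra.repr.injective (Finsupp.ext fun s => ?_)
  simp only [map_smul, Finsupp.smul_apply, smul_eq_mul, repr_extProj, proj_mul_of_mem 𝒜 ha]
  congr 3
  ring

theorem extProj_add (k : ℤ) (x y : ExteriorAlgebra R F) :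
    extProj 𝒜 f e k (x + y) = extProj 𝒜 f e k x + extProj 𝒜 f e k y := by
  refine f.ExteriorAlgebra.repr.injective (Finsupp.ext fun s => ?_)
  simp only [map_add, Finsupp.add_apply, repr_extProj]

theorem extProj_zero (k : ℤ) : extProj 𝒜 f e k 0 = 0 := by
  simp [extProj]

theorem extProj_extProj (k : ℤ) (x : ExteriorAlgebra R F) :
    extProj 𝒜 f e k (extProj 𝒜 f e k x) = extProj 𝒜 f e k x := by
  refine f.ExteriorAlgebra.repr.injective (Finsupp.ext fun s => ?_)
  simp [repr_extProj, GradedRing.proj_apply]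

theorem extProj_mem_extSub (k : ℤ) {T : Finset (Fin n)} {a : ℕ} {x : ExteriorAlgebra R F}
    (hx : x ∈ extSub f T a) : extProj 𝒜 f e k x ∈ extSub f T a := by
  rw [mem_extSub_iff_repr] at hx ⊢
  refine fun s hs => hx s fun h => hs ?_
  rw [repr_extProj, h, map_zero]

theorem exists_sum_extProj (x : ExteriorAlgebra R F) :
    ∃ K : Finset ℤ, ∑ k ∈ K, extProj 𝒜 f e k x = x := by
  classical
  -- The degrees that occur: those of the components of each coordinate, shifted by the degree of
  -- `f_s`.
  refine ⟨Finset.univ.biUnion fun s : Finset (Fin n) =>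
    ((DirectSum.decompose 𝒜 (f.ExteriorAlgebra.repr x s)).support).image (· + ∑ i ∈ s, e i), ?_⟩
  refine f.ExteriorAlgebra.repr.injective (Finsupp.ext fun s => ?_)
  simp only [map_sum, Finsupp.coe_finsetSum, Finset.sum_apply, repr_extProj]
  rw [← Finset.sum_subset (Finset.subset_biUnion_of_mem (fun s : Finset (Fin n) =>
    ((DirectSum.decompose 𝒜 (f.ExteriorAlgebra.repr x s)).support).image (· + ∑ i ∈ s, e i))
    (Finset.mem_univ s)), Finset.sum_image (fun _ _ _ _ h => by simpa using h)]
  · simp only [add_sub_cancel_right, GradedRing.proj_apply]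
    exact DirectSum.sum_support_decompose 𝒜 (f.ExteriorAlgebra.repr x s)
  · intro k _ hk
    by_contra hne
    refine hk (Finset.mem_image.2 ⟨k - ∑ i ∈ s, e i, ?_, by ring⟩)
    rw [DFinsupp.mem_support_iff]
    exact fun h => hne (by rw [GradedRing.proj_apply, h]; rfl)

/-- A graded Nakayama argument without finiteness. A homogeneous cycle of degree `k` is a boundary
plus `ψ(f_t)` times a cycle that may be taken homogeneous of the smaller degree `k - e t`, and in
negative degrees everything vanishes. General cycles are sums of homogeneous ones. -/
theorem KoszulExact.of_insert_of_graded (h𝒜 : ∀ i < 0, 𝒜 i = ⊥) (hpos : ∀ i, 0 < e i)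
    (he : ∀ i, ψ (f i) ∈ 𝒜 (e i)) {T : Finset (Fin n)} {t : Fin n}
    (h : KoszulExact f ψ (insert t T)) (ht : t ∉ T) : KoszulExact f ψ T := by
  intro a
  have key : ∀ N : ℕ, ∀ k : ℤ, k < N → ∀ x ∈ extSub f T (a + 1), kos ψ x = 0 →
      extProj 𝒜 f e k x = x → ∃ y ∈ extSub f T (a + 2), kos ψ y = x := by
    intro N
    induction N with
    | zero =>
      intro k hk x hx _ hxk
      refine ⟨0, zero_mem _, ?_⟩
      rw [map_zero, eq_comm, ← hxk]
      refine f.ExteriorAlgebra.repr.injective (Finsupp.ext fun s => ?_)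
      rw [repr_extProj]
      have h0 := h𝒜 (k - ∑ i ∈ s, e i) (by
        have : 0 ≤ ∑ i ∈ s, e i := Finset.sum_nonneg fun i _ => (hpos i).le
        simp at hk
        omega)
      have h1 : GradedRing.proj 𝒜 (k - ∑ i ∈ s, e i) (f.ExteriorAlgebra.repr x s) ∈
        𝒜 (k - ∑ i ∈ s, e i) := SetLike.coe_mem _
      rw [h0, AddSubgroup.mem_bot] at h1
      simpa using h1
    | succ N ih =>
      intro k hk x hx hx0 hxk
      obtain ⟨y, hy, z, hz, hz0, hxyz⟩ := h.exists_of_insert ht hx hx0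
      obtain ⟨u, hu, huz⟩ := ih (k - e t) (by have := hpos t; push_cast at hk; omega)
        (extProj 𝒜 f e (k - e t) z) (extProj_mem_extSub _ hz)
        (by rw [kos_extProj he, hz0, extProj_zero]) (extProj_extProj _ _)
      refine ⟨extProj 𝒜 f e k y + ψ (f t) • u,
        add_mem (extProj_mem_extSub _ hy) (Submodule.smul_mem _ _ hu), ?_⟩
      rw [map_add, map_smul, huz, kos_extProj he, ← extProj_smul k (e t) (he t), ← extProj_add,
        ← hxyz, hxk]
  intro x hx hx0
  obtain ⟨K, hK⟩ := exists_sum_extProj (𝒜 := 𝒜) (f := f) (e := e) x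
  choose! y hy hyx using fun k : ℤ => key (k + 1).toNat k (by omega) (extProj 𝒜 f e k x)
    (extProj_mem_extSub _ hx) (by rw [kos_extProj he, hx0, extProj_zero]) (extProj_extProj _ _)
  exact ⟨∑ k ∈ K, y k, Submodule.sum_mem _ fun k _ => hy k, by simp [hyx, hK]⟩

end Graded

/-! ### The monomial basis of `⋀ F ⊗ S F` and multidegrees -/

/-- The basis of the symmetric algebra formed by the monomials in the `f i`. -/
def symBasis (f : Module.Basis (Fin n) R F) :
    Module.Basis (Fin n → ℕ) R (SymmetricAlgebra R F) :=
  f.symmetricAlgebra.reindex Finsupp.equivFunOnFinite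

theorem symBasis_apply (f : Module.Basis (Fin n) R F) (α : Fin n → ℕ) :
    symBasis f α = monomial f α := by
  simp only [symBasis, Module.Basis.reindex_apply, Module.Basis.symmetricAlgebra,
    Module.Basis.map_apply, MvPolynomial.coe_basisMonomials, monomial]
  rw [MvPolynomial.monomial_eq, Finsupp.prod_fintype _ _ (by simp)]
  simp

/-- The basis of `⋀ F ⊗ S F` formed by the `f_s ⊗ f^α`. -/
def tensorBasis (f : Module.Basis (Fin n) R F) :
    Module.Basis (Finset (Fin n) × (Fin n → ℕ)) R
      (ExteriorAlgebra R F ⊗[R] SymmetricAlgebra R F) :=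
  f.ExteriorAlgebra.tensorProduct (symBasis f)

theorem tensorBasis_apply (f : Module.Basis (Fin n) R F) (s : Finset (Fin n)) (α : Fin n → ℕ) :
    tensorBasis f (s, α) = f.ExteriorAlgebra s ⊗ₜ monomial f α := by
  rw [tensorBasis, Module.Basis.tensorProduct_apply, symBasis_apply]

/-- The multidegree of `f_s ⊗ f^α`. -/
def tdeg (p : Finset (Fin n) × (Fin n → ℕ)) (i : Fin n) : ℕ :=
  (if i ∈ p.1 then 1 else 0) + p.2 i

theorem sum_tdeg (p : Finset (Fin n) × (Fin n → ℕ)) :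
    ∑ i, tdeg p i = p.1.card + ∑ i, p.2 i := by
  simp [tdeg, Finset.sum_add_distrib]

/-- The set of indices `(s, α)` of the basis elements `f_s ⊗ f^α` of `(⋀ᵃ F ⊗ S_b F)_w`. -/
def indexSet (w : Fin n → ℕ) (a b : ℕ) : Set (Finset (Fin n) × (Fin n → ℕ)) :=
  {p | p.1.card = a ∧ ∑ i, p.2 i = b ∧ tdeg p ≤ w}

theorem indexSet_finite (w : Fin n → ℕ) (a b : ℕ) : (indexSet w a b).Finite := by
  refine Set.Finite.subset (Set.finite_univ.prod (Set.finite_Iic w)) ?_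
  rintro p ⟨-, -, h⟩
  exact ⟨trivial, fun i => le_trans (Nat.le_add_left _ _) (h i)⟩

theorem mdeg_eq_tdeg {a : ℕ} (σ : Fin a ↪o Fin n) (α : Fin n → ℕ) :
    mdeg σ α = tdeg (Finset.univ.map σ.toEmbedding, α) := by
  ext i
  simp only [mdeg, tdeg, Pi.add_apply, Finset.sum_apply, Pi.single_apply]
  congr 1
  split_ifs with h
  · obtain ⟨j, -, rfl⟩ := Finset.mem_map.1 h
    rw [Finset.sum_eq_single j] <;> simp +contextual [eq_comm]
  · refine Finset.sum_eq_zero fun j _ => if_neg ?_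
    rintro rfl
    exact h (by simp)

theorem restricted_eq_span (f : Module.Basis (Fin n) R F) (w : Fin n → ℕ) (a b : ℕ) :
    restricted f w a b = Submodule.span R (tensorBasis f '' indexSet w a b) := by
  rw [restricted]
  congr 1
  ext z
  constructor
  · rintro ⟨σ, α, hα, hw, rfl⟩
    refine ⟨(Finset.univ.map σ.toEmbedding, α), ⟨by simp, hα, mdeg_eq_tdeg σ α ▸ hw⟩, ?_⟩
    rw [tensorBasis_apply, wedge_eq_basis f σ rfl]
  · rintro ⟨⟨s, α⟩, ⟨hs, hα, hw⟩, rfl⟩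
    have h := Finset.map_orderEmbOfFin_univ s hs
    refine ⟨s.orderEmbOfFin hs, α, hα, ?_, ?_⟩
    · rwa [mdeg_eq_tdeg, h]
    · rw [tensorBasis_apply, wedge_eq_basis f _ h]

theorem mem_restricted_iff (f : Module.Basis (Fin n) R F) {w : Fin n → ℕ} {a b : ℕ}
    {z : ExteriorAlgebra R F ⊗[R] SymmetricAlgebra R F} :
    z ∈ restricted f w a b ↔ ∀ p, (tensorBasis f).repr z p ≠ 0 → p ∈ indexSet w a b := by
  rw [restricted_eq_span, Module.Basis.mem_span_image]
  simp [Set.subset_def]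

theorem tensorBasis_mem_restricted (f : Module.Basis (Fin n) R F) {w : Fin n → ℕ} {a b : ℕ}
    {p : Finset (Fin n) × (Fin n → ℕ)} (hp : p ∈ indexSet w a b) :
    tensorBasis f p ∈ restricted f w a b := by
  rw [restricted_eq_span]
  exact Submodule.subset_span ⟨p, hp, rfl⟩

theorem restricted_le_comap (f : Module.Basis (Fin n) R F) {w : Fin n → ℕ} {a b : ℕ}
    {N : Type*} [AddCommMonoid N] [Module R N]
    (g : ExteriorAlgebra R F ⊗[R] SymmetricAlgebra R F →ₗ[R] N) (P : Submodule R N)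
    (h : ∀ p ∈ indexSet w a b, g (tensorBasis f p) ∈ P) :
    restricted f w a b ≤ P.comap g := by
  rw [restricted_eq_span, Submodule.span_le]
  rintro _ ⟨p, hp, rfl⟩
  exact h p hp

theorem ι_mul_monomial (f : Module.Basis (Fin n) R F) (i : Fin n) (α : Fin n → ℕ) :
    SymmetricAlgebra.ι R F (f i) * monomial f α = monomial f (α + Pi.single i 1) := by
  simp only [monomial, Pi.add_apply, pow_add, Finset.prod_mul_distrib]
  rw [mul_comm]
  congr 1
  rw [Finset.prod_eq_single i] <;> simp +contextual

/-! ### The two differentials and the evaluation map -/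

theorem kosTensor_tensorBasis (f : Module.Basis (Fin n) R F) (ψ : F →ₗ[R] R)
    (s : Finset (Fin n)) (α : Fin n → ℕ) :
    kosTensor ψ (tensorBasis f (s, α)) =
      ∑ i ∈ s, (sgn R i s * ψ (f i)) • tensorBasis f (s.erase i, α) := by
  simp only [tensorBasis_apply, kosTensor, TensorProduct.map_tmul, kos_extBasis,
    TensorProduct.sum_tmul, TensorProduct.smul_tmul', LinearMap.id_apply]

theorem kappa_tensorBasis (f : Module.Basis (Fin n) R F) (s : Finset (Fin n)) (α : Fin n → ℕ) :
    kappa f (tensorBasis f (s, α)) =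
      ∑ i ∈ s, sgn R i s • tensorBasis f (s.erase i, α + Pi.single i 1) := by
  simp only [tensorBasis_apply, kappa_tmul, kos_extBasis, ι_mul_monomial, TensorProduct.sum_tmul]
  rw [Finset.sum_comm]
  refine Finset.sum_congr rfl fun i _ => ?_
  rw [Finset.sum_eq_single i]
  · simp [TensorProduct.smul_tmul']
  · intro j _ hj
    simp [hj.symm]
  · simp

theorem kappa_kappa (f : Module.Basis (Fin n) R F)
    (z : ExteriorAlgebra R F ⊗[R] SymmetricAlgebra R F) : kappa f (kappa f z) = 0 := by
  induction z with
  | zero => simp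
  | add x y hx hy => rw [map_add, map_add, hx, hy, add_zero]
  | tmul x s =>
    simp only [kappa_tmul, map_sum]
    rw [← Finset.sum_product']
    -- The terms `(i, j)` and `(j, i)` cancel, since contractions anticommute and the symmetric
    -- algebra is commutative; the diagonal terms vanish.
    refine Finset.sum_involution (fun q _ => (q.2, q.1)) ?_ ?_ (by simp) (by simp)
    · rintro ⟨i, j⟩ _
      rw [kos_comm, TensorProduct.neg_tmul, mul_left_comm, neg_add_cancel]
    · rintro ⟨i, j⟩ _ h e
      obtain rfl : j = i := congrArg Prod.fst e
      exact h (by simp [kos_kos])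

/-- Multiplying by `f_i` before evaluating is the same as scaling by `ψ(f_i)`. This yields the
complex property at `(S_d)_w` and replaces anticommutation in the last step of the exactness proof.
-/
theorem symEval_kappa (f : Module.Basis (Fin n) R F) (ψ : F →ₗ[R] R)
    (z : ExteriorAlgebra R F ⊗[R] SymmetricAlgebra R F) :
    symEval ψ (kappa f z) = symEval ψ (kosTensor ψ z) := by
  induction z with
  | zero => simp
  | add x y hx hy => simp only [map_add, hx, hy]
  | tmul x s =>
    rw [kappa_tmul, kosTensor, TensorProduct.map_tmul, kos_eq_sum f ψ x]
    simp only [symEval, map_sum, LinearMap.comp_apply, TensorProduct.map_tmul, LinearMap.id_apply,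
      LinearMap.mul'_apply, AlgHom.toLinearMap_apply, map_mul, map_smul, smul_eq_mul,
      SymmetricAlgebra.lift_ι_apply, Finset.sum_mul]
    exact Finset.sum_congr rfl fun i _ => by ring

theorem symEval_kosTensor (ψ : F →ₗ[R] R) (f : Module.Basis (Fin n) R F) {w : Fin n → ℕ} {b : ℕ}
    {z : ExteriorAlgebra R F ⊗[R] SymmetricAlgebra R F} (hz : z ∈ L f w 1 b) :
    symEval ψ (kosTensor ψ z) = 0 := by
  rw [← symEval_kappa f, show kappa f z = 0 from hz.2, map_zero]

theorem kosTensor_kosTensor (ψ : F →ₗ[R] R)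
    (z : ExteriorAlgebra R F ⊗[R] SymmetricAlgebra R F) : kosTensor ψ (kosTensor ψ z) = 0 := by
  induction z with
  | zero => simp
  | add x y hx hy => rw [map_add, map_add, hx, hy, add_zero]
  | tmul x s => simp [kosTensor, kos_kos]

theorem symEval_tensorBasis_empty (ψ : F →ₗ[R] R) (f : Module.Basis (Fin n) R F) (α : Fin n → ℕ) :
    symEval ψ (tensorBasis f (∅, α)) = ∏ i, ψ (f i) ^ α i := by
  simp [tensorBasis_apply, extBasis_empty, symEval, monomial]

/-! ### The contracting homotopy of `κ` -/

/-- `v` is the smallest element of the support of `β`. -/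
def IsPivot (β : Fin n → ℕ) (v : Fin n) : Prop := β v ≠ 0 ∧ ∀ j < v, β j = 0

theorem IsPivot.unique {β : Fin n → ℕ} {v v' : Fin n} (h : IsPivot β v) (h' : IsPivot β v') :
    v = v' := by
  rcases lt_trichotomy v v' with hlt | rfl | hlt
  · exact absurd (h'.2 v hlt) h.1
  · rfl
  · exact absurd (h.2 v' hlt) h'.1

theorem exists_isPivot {β : Fin n → ℕ} (h : β ≠ 0) : ∃ v, IsPivot β v := by
  have hne : (Finset.univ.filter fun i => β i ≠ 0).Nonempty := by
    obtain ⟨i, hi⟩ := Function.ne_iff.1 h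
    exact ⟨i, by simpa using hi⟩
  refine ⟨Finset.min' _ hne, (Finset.mem_filter.1 (Finset.min'_mem _ hne)).2, fun j hj => ?_⟩
  by_contra h0
  exact absurd (Finset.min'_le _ j (by simpa using h0)) (not_le.2 hj)

open Classical in
/-- The contracting homotopy of the tautological Koszul complex: it multiplies `f_s ⊗ f^α` by
`f_v ⊗ f_v⁻¹`, where `v` is the smallest index that occurs in `f_s ⊗ f^α`. -/
def homotopy (f : Module.Basis (Fin n) R F) :
    ExteriorAlgebra R F ⊗[R] SymmetricAlgebra R F →ₗ[R]
      ExteriorAlgebra R F ⊗[R] SymmetricAlgebra R F :=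
  (tensorBasis f).constr R fun p => ∑ v, if IsPivot (tdeg p) v ∧ v ∉ p.1 then
    -- The truncated subtraction loses nothing: `v` occurs in the multidegree but not in `p.1`, so
    -- `p.2 v > 0`.
    tensorBasis f (insert v p.1, p.2 - Pi.single v 1) else 0

theorem homotopy_of_notMem (f : Module.Basis (Fin n) R F) {p : Finset (Fin n) × (Fin n → ℕ)}
    {v : Fin n} (hv : IsPivot (tdeg p) v) (hp : v ∉ p.1) :
    homotopy f (tensorBasis f p) = tensorBasis f (insert v p.1, p.2 - Pi.single v 1) := by
  rw [homotopy, Module.Basis.constr_basis, Finset.sum_eq_single v]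
  · rw [if_pos ⟨hv, hp⟩]
  · intro j _ hj
    exact if_neg fun h => hj (h.1.unique hv)
  · simp

theorem homotopy_of_mem (f : Module.Basis (Fin n) R F) {p : Finset (Fin n) × (Fin n → ℕ)}
    {v : Fin n} (hv : IsPivot (tdeg p) v) (hp : v ∈ p.1) :
    homotopy f (tensorBasis f p) = 0 := by
  rw [homotopy, Module.Basis.constr_basis]
  refine Finset.sum_eq_zero fun j _ => if_neg ?_
  rintro ⟨h, hj⟩
  exact hj (h.unique hv ▸ hp)

theorem homotopy_of_tdeg_eq_zero (f : Module.Basis (Fin n) R F)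
    {p : Finset (Fin n) × (Fin n → ℕ)} (hp : tdeg p = 0) : homotopy f (tensorBasis f p) = 0 := by
  rw [homotopy, Module.Basis.constr_basis]
  refine Finset.sum_eq_zero fun j _ => if_neg ?_
  rintro ⟨h, hj⟩
  exact h.1 (by rw [hp]; rfl)

theorem tdeg_erase {s : Finset (Fin n)} {α : Fin n → ℕ} {i : Fin n} (hi : i ∈ s) :
    tdeg (s.erase i, α + Pi.single i 1) = tdeg (s, α) := by
  ext j
  by_cases h : j = i
  · subst h; simp [tdeg, hi, add_comm]
  · simp [tdeg, h]

theorem ne_zero_of_isPivot {s : Finset (Fin n)} {α : Fin n → ℕ} {v : Fin n}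
    (h : IsPivot (tdeg (s, α)) v) (hv : v ∉ s) : α v ≠ 0 := by
  simpa [tdeg, hv] using h.1

theorem sub_single_add_single {α : Fin n → ℕ} {v : Fin n} (h : α v ≠ 0) :
    α - Pi.single v 1 + Pi.single v 1 = α := by
  ext j
  by_cases hj : j = v
  · subst hj; simp; omega
  · simp [hj]

/-- Together with `tdeg_erase`, this makes `κ` and its homotopy compatible with every bound `w`, and
keeps the pivot unchanged. -/
theorem tdeg_insert {s : Finset (Fin n)} {α : Fin n → ℕ} {v : Fin n}
    (h : IsPivot (tdeg (s, α)) v) (hv : v ∉ s) :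
    tdeg (insert v s, α - Pi.single v 1) = tdeg (s, α) := by
  have h1 := tdeg_erase (s := insert v s) (α := α - Pi.single v 1) (Finset.mem_insert_self v s)
  rw [← h1, Finset.erase_insert hv, sub_single_add_single (ne_zero_of_isPivot h hv)]

theorem le_of_isPivot {s : Finset (Fin n)} {α : Fin n → ℕ} {v : Fin n}
    (h : IsPivot (tdeg (s, α)) v) {i : Fin n} (hi : i ∈ s) : v ≤ i := by
  by_contra hlt
  have := h.2 i (not_le.1 hlt)
  simp [tdeg, hi] at this

theorem sgn_of_forall_le {s : Finset (Fin n)} {v : Fin n} (h : ∀ i ∈ s, v ≤ i) :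
    sgn R v s = 1 := by
  have : s.filter (· < v) = ∅ := Finset.filter_eq_empty_iff.2 fun i hi => not_lt.2 (h i hi)
  simp [sgn, this]

theorem kappa_homotopy_add (f : Module.Basis (Fin n) R F) {p : Finset (Fin n) × (Fin n → ℕ)}
    (hp : tdeg p ≠ 0) :
    kappa f (homotopy f (tensorBasis f p)) + homotopy f (kappa f (tensorBasis f p)) =
      tensorBasis f p := by
  obtain ⟨v, hv⟩ := exists_isPivot hp
  obtain ⟨s, α⟩ := p
  have hpiv : ∀ i ∈ s, IsPivot (tdeg (s.erase i, α + Pi.single i 1)) v := fun i hi => by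
    rwa [tdeg_erase hi]
  rw [kappa_tensorBasis, map_sum]
  simp only [map_smul]
  by_cases hvs : v ∈ s
  -- If `v ∈ s`, only the term of `κ` that moves `v` to the symmetric factor survives the homotopy,
  -- which moves it back.
  · rw [homotopy_of_mem f hv hvs, map_zero, zero_add, Finset.sum_eq_single_of_mem v hvs]
    · rw [homotopy_of_notMem f (hpiv v hvs) (by simp), sgn_of_forall_le fun i => le_of_isPivot hv,
        one_smul]
      simp [Finset.insert_erase hvs]
    · intro i hi hiv
      rw [homotopy_of_mem f (hpiv i hi) (by simp [hvs, hiv.symm]), smul_zero]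
  -- If `v ∉ s`, the `v` term of `κ h` restores the basis element. The others cancel against `h κ`,
  -- as inserting `v` flips the signs of all `i ∈ s`.
  · rw [homotopy_of_notMem f hv hvs, kappa_tensorBasis, Finset.sum_insert hvs,
      Finset.erase_insert hvs, sub_single_add_single (ne_zero_of_isPivot hv hvs),
      sgn_of_forall_le, one_smul, add_assoc, ← Finset.sum_add_distrib,
      Finset.sum_eq_zero, add_zero]
    · intro i hi
      have hne : v ≠ i := fun e => hvs (e ▸ hi)
      have hlt : v < i := lt_of_le_of_ne (le_of_isPivot hv hi) hne
      rw [homotopy_of_notMem f (hpiv i hi) (by simp [hvs]), Finset.erase_insert_of_ne hne,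
        show sgn R i (insert v s) = - sgn R i s by
          rw [sgn, sgn, Finset.filter_insert, if_pos hlt, Finset.card_insert_of_notMem
            (by simp [hvs]), pow_succ]
          ring]
      have : α - Pi.single v 1 + Pi.single i 1 = α + Pi.single i 1 - Pi.single v 1 := by
        have := ne_zero_of_isPivot hv hvs
        ext j
        by_cases hj : j = v
        · subst hj; simp [hne]
        · simp [hj]
      rw [this, ← add_smul, neg_add_cancel, zero_smul]
    · intro i hi
      rcases Finset.mem_insert.1 hi with rfl | hi
      · exact le_rfl
      · exact le_of_isPivot hv hi

theorem kappa_mem_restricted (f : Module.Basis (Fin n) R F) {w : Fin n → ℕ} {a b : ℕ}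
    {z : ExteriorAlgebra R F ⊗[R] SymmetricAlgebra R F} (hz : z ∈ restricted f w (a + 1) b) :
    kappa f z ∈ restricted f w a (b + 1) := by
  refine restricted_le_comap f (kappa f) (restricted f w a (b + 1)) ?_ hz
  rintro ⟨s, α⟩ ⟨hs, hα, hw⟩
  rw [kappa_tensorBasis]
  refine Submodule.sum_mem _ fun i hi => Submodule.smul_mem _ _ (tensorBasis_mem_restricted f ?_)
  refine ⟨by simp [Finset.card_erase_of_mem hi, show s.card = a + 1 from hs], ?_,
    by rwa [tdeg_erase hi]⟩
  simp [Finset.sum_add_distrib, show ∑ i, α i = b from hα]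

theorem homotopy_mem_restricted (f : Module.Basis (Fin n) R F) {w : Fin n → ℕ} {a b : ℕ}
    {z : ExteriorAlgebra R F ⊗[R] SymmetricAlgebra R F} (hz : z ∈ restricted f w a (b + 1)) :
    homotopy f z ∈ restricted f w (a + 1) b := by
  refine restricted_le_comap f (homotopy f) (restricted f w (a + 1) b) ?_ hz
  rintro ⟨s, α⟩ ⟨hs, hα, hw⟩
  by_cases h0 : tdeg (s, α) = 0
  · rw [homotopy_of_tdeg_eq_zero f h0]
    exact zero_mem _
  obtain ⟨v, hv⟩ := exists_isPivot h0
  by_cases hvs : v ∈ s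
  · rw [homotopy_of_mem f hv hvs]
    exact zero_mem _
  · rw [homotopy_of_notMem f hv hvs]
    refine tensorBasis_mem_restricted f ⟨?_, ?_, by rwa [tdeg_insert hv hvs]⟩
    · simp [hvs, show s.card = a from hs]
    · have h1 := sum_tdeg (s, α)
      rw [← tdeg_insert hv hvs, sum_tdeg] at h1
      simp only [Finset.card_insert_of_notMem hvs, show ∑ i, α i = b + 1 from hα] at h1
      simp only
      omega

/-- With no symmetric factor, any pivot already lies in the exterior factor. -/
theorem homotopy_eq_zero_of_mem_restricted (f : Module.Basis (Fin n) R F) {w : Fin n → ℕ} {a : ℕ}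
    {z : ExteriorAlgebra R F ⊗[R] SymmetricAlgebra R F} (hz : z ∈ restricted f w a 0) :
    homotopy f z = 0 := by
  refine (Submodule.mem_bot R).1 (restricted_le_comap f (homotopy f) ⊥ ?_ hz)
  rintro ⟨s, α⟩ ⟨hs, hα, hw⟩
  rw [Submodule.mem_bot]
  by_cases h0 : tdeg (s, α) = 0
  · rw [homotopy_of_tdeg_eq_zero f h0]
  obtain ⟨v, hv⟩ := exists_isPivot h0
  refine homotopy_of_mem f hv ?_
  by_contra hvs
  exact ne_zero_of_isPivot hv hvs (Finset.sum_eq_zero_iff.1 hα v (Finset.mem_univ v))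

theorem tdeg_ne_zero_of_mem_indexSet {w : Fin n → ℕ} {a b : ℕ} (hab : a + b ≠ 0)
    {p : Finset (Fin n) × (Fin n → ℕ)} (hp : p ∈ indexSet w a b) : tdeg p ≠ 0 := by
  intro h
  have := sum_tdeg p
  rw [h, hp.1, hp.2.1] at this
  simp at this
  omega

/-- The homotopy contracts `κ` on `(⋀ᵃ F ⊗ S_b F)_w` if `a + b ≠ 0`. -/
theorem kappa_homotopy_add_of_mem (f : Module.Basis (Fin n) R F) {w : Fin n → ℕ} {a b : ℕ}
    (hab : a + b ≠ 0) {z : ExteriorAlgebra R F ⊗[R] SymmetricAlgebra R F}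
    (hz : z ∈ restricted f w a b) :
    kappa f (homotopy f z) + homotopy f (kappa f z) = z := by
  have := restricted_le_comap f (kappa f ∘ₗ homotopy f + homotopy f ∘ₗ kappa f - LinearMap.id) ⊥
    (fun p hp => ?_) hz
  · rw [Submodule.mem_comap, Submodule.mem_bot] at this
    exact sub_eq_zero.1 this
  · rw [Submodule.mem_bot]
    exact sub_eq_zero.2 (kappa_homotopy_add f (tdeg_ne_zero_of_mem_indexSet hab hp))

theorem kappa_homotopy_of_mem_L (f : Module.Basis (Fin n) R F) {w : Fin n → ℕ} {a b : ℕ}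
    (hab : a + b ≠ 0) {z : ExteriorAlgebra R F ⊗[R] SymmetricAlgebra R F} (hz : z ∈ L f w a b) :
    kappa f (homotopy f z) = z := by
  have h := kappa_homotopy_add_of_mem f hab hz.1
  rwa [show kappa f z = 0 from hz.2, map_zero, add_zero] at h

theorem kappa_mem_L (f : Module.Basis (Fin n) R F) {w : Fin n → ℕ} {a b : ℕ}
    {z : ExteriorAlgebra R F ⊗[R] SymmetricAlgebra R F} (hz : z ∈ restricted f w (a + 1) b) :
    kappa f z ∈ L f w a (b + 1) :=
  ⟨kappa_mem_restricted f hz, kappa_kappa f z⟩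

/-! ### Exactness of the rows -/

/-- The coefficient of `f^α` in an element of `⋀ F ⊗ S F`. -/
def slice (f : Module.Basis (Fin n) R F) (α : Fin n → ℕ) :
    ExteriorAlgebra R F ⊗[R] SymmetricAlgebra R F →ₗ[R] ExteriorAlgebra R F :=
  (TensorProduct.rid R _).toLinearMap ∘ₗ LinearMap.lTensor _ ((symBasis f).coord α)

theorem slice_tmul (f : Module.Basis (Fin n) R F) (α : Fin n → ℕ) (x : ExteriorAlgebra R F)
    (s : SymmetricAlgebra R F) : slice f α (x ⊗ₜ s) = (symBasis f).repr s α • x := by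
  simp [slice]

theorem slice_kosTensor (f : Module.Basis (Fin n) R F) (ψ : F →ₗ[R] R) (α : Fin n → ℕ)
    (z : ExteriorAlgebra R F ⊗[R] SymmetricAlgebra R F) :
    slice f α (kosTensor ψ z) = kos ψ (slice f α z) := by
  induction z with
  | zero => simp
  | add x y hx hy => simp only [map_add, hx, hy]
  | tmul x s => simp [kosTensor, slice_tmul]

theorem repr_slice (f : Module.Basis (Fin n) R F) (α : Fin n → ℕ) (s : Finset (Fin n))
    (z : ExteriorAlgebra R F ⊗[R] SymmetricAlgebra R F) :
    f.ExteriorAlgebra.repr (slice f α z) s = (tensorBasis f).repr z (s, α) := by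
  induction z with
  | zero => simp
  | add x y hx hy => simp only [map_add, Finsupp.add_apply, hx, hy]
  | tmul x t => simp [tensorBasis, slice_tmul]

theorem repr_tmul_monomial (f : Module.Basis (Fin n) R F) (x : ExteriorAlgebra R F)
    (α : Fin n → ℕ) (p : Finset (Fin n) × (Fin n → ℕ)) :
    (tensorBasis f).repr (x ⊗ₜ monomial f α) p =
      if α = p.2 then f.ExteriorAlgebra.repr x p.1 else 0 := by
  obtain ⟨s, β⟩ := p
  rw [← symBasis_apply]
  simp [tensorBasis, Finsupp.single_apply]

/-- The bound `w` on `f_s ⊗ f^α` says that `α ≤ w` and that `s` avoids the indices with `α_i = w_i`.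
So `Kos ⊗ 1` is a direct sum of Koszul complexes of subfamilies, which is why exactness is required
for all `T`. -/
theorem exists_kosTensor_eq (f : Module.Basis (Fin n) R F) (ψ : F →ₗ[R] R)
    (hK : ∀ T, KoszulExact f ψ T) {w : Fin n → ℕ} {a b : ℕ}
    {y : ExteriorAlgebra R F ⊗[R] SymmetricAlgebra R F} (hy : y ∈ restricted f w (a + 1) b)
    (hy0 : kosTensor ψ y = 0) : ∃ u ∈ restricted f w (a + 2) b, kosTensor ψ u = y := by
  classical
  have hsl : ∀ α, slice f α y ∈ extSub f (Finset.univ.filter fun i => α i < w i) (a + 1) := by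
    intro α
    rw [mem_extSub_iff_repr]
    intro s hs
    rw [repr_slice] at hs
    obtain ⟨h1, h2, h3⟩ := (mem_restricted_iff f).1 hy _ hs
    refine ⟨fun i hi => ?_, h1⟩
    have := h3 i
    simp only [tdeg, if_pos hi] at this
    simp
    omega
  choose u hu huy using fun α => hK _ a _ (hsl α) (by rw [← slice_kosTensor, hy0, map_zero])
  -- Outside `A` the slices of `y` vanish, so the chosen preimages there are discarded.
  set A := (Finset.Iic w).filter (fun α => ∑ i, α i = b) with hA
  refine ⟨∑ α ∈ A, u α ⊗ₜ monomial f α, Submodule.sum_mem _ fun α hα => ?_, ?_⟩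
  · rw [mem_restricted_iff]
    rintro ⟨s, β⟩ hp
    rw [repr_tmul_monomial] at hp
    obtain ⟨rfl, hs⟩ := by simpa only [ne_eq, ite_eq_right_iff, Classical.not_imp] using hp
    obtain ⟨h1, h2⟩ := mem_extSub_iff_repr f |>.1 (hu α) s hs
    obtain ⟨h3, h4⟩ := Finset.mem_filter.1 hα
    refine ⟨h2, h4, fun i => ?_⟩
    simp only [tdeg]
    split_ifs with hi
    · have := (Finset.mem_filter.1 (h1 hi)).2
      omega
    · simpa using Finset.mem_Iic.1 h3 i
  · rw [map_sum]
    simp only [kosTensor, TensorProduct.map_tmul, LinearMap.id_apply, huy]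
    refine (tensorBasis f).repr.injective (Finsupp.ext fun p => ?_)
    obtain ⟨s, β⟩ := p
    simp only [map_sum, Finsupp.coe_finsetSum, Finset.sum_apply, repr_tmul_monomial, repr_slice,
      Finset.sum_ite_eq']
    split_ifs with hβ
    · rfl
    · by_contra hne
      obtain ⟨h1, h2, h3⟩ := (mem_restricted_iff f).1 hy _ (Ne.symm hne)
      exact hβ (Finset.mem_filter.2 ⟨Finset.mem_Iic.2 fun i =>
        le_trans (Nat.le_add_left _ _) (h3 i), h2⟩)

/-! ### Exactness of the complex -/

theorem eq_zero_of_mem_L_zero (f : Module.Basis (Fin n) R F) {w : Fin n → ℕ} {a : ℕ}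
    {z : ExteriorAlgebra R F ⊗[R] SymmetricAlgebra R F} (hz : z ∈ L f w (a + 1) 0) : z = 0 := by
  rw [← kappa_homotopy_of_mem_L f (by omega) hz, homotopy_eq_zero_of_mem_restricted f hz.1,
    map_zero]

/-- `(S_0)_w` lies in the span of `1 ⊗ 1`, which evaluates to 1; this is the base case `d = 0`. -/
theorem eq_zero_of_symEval_eq_zero (f : Module.Basis (Fin n) R F) (ψ : F →ₗ[R] R) {w : Fin n → ℕ}
    {z : ExteriorAlgebra R F ⊗[R] SymmetricAlgebra R F} (hz : z ∈ restricted f w 0 0)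
    (h : symEval ψ z = 0) : z = 0 := by
  have hle : restricted f w 0 0 ≤ Submodule.span R {tensorBasis f (∅, 0)} := by
    rw [restricted_eq_span]
    refine Submodule.span_mono ?_
    rintro _ ⟨⟨s, α⟩, ⟨hs, hα, -⟩, rfl⟩
    obtain rfl : s = ∅ := Finset.card_eq_zero.1 hs
    obtain rfl : α = 0 := funext fun i => Finset.sum_eq_zero_iff.1 hα i (Finset.mem_univ i)
    rfl
  obtain ⟨c, rfl⟩ := Submodule.mem_span_singleton.1 (hle hz)
  rw [map_smul, symEval_tensorBasis_empty] at h
  simp at h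
  rw [h, zero_smul]

/-- The inductive step of the proof of exactness: if `z = κ y` and `Kos y` bounds in
`L_{b}`, then `z` bounds in `L_{b + 1}`. -/
theorem exists_kosTensor_eq_of_kappa (f : Module.Basis (Fin n) R F) (ψ : F →ₗ[R] R)
    (hK : ∀ T, KoszulExact f ψ T) {w : Fin n → ℕ} {a b : ℕ}
    {y y' : ExteriorAlgebra R F ⊗[R] SymmetricAlgebra R F} (hy : y ∈ restricted f w (a + 1) b)
    (hy' : y' ∈ L f w (a + 1) b) (h : kosTensor ψ y' = kosTensor ψ y) :
    ∃ u ∈ L f w (a + 1) (b + 1), kosTensor ψ u = kappa f y := by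
  obtain ⟨u, hu, huy⟩ := exists_kosTensor_eq f ψ hK (sub_mem hy hy'.1)
    (by rw [map_sub, h, sub_self])
  -- The sign compensates for the anticommutation of `κ` and `Kos ⊗ 1`.
  refine ⟨-kappa f u, neg_mem (kappa_mem_L f hu), ?_⟩
  rw [map_neg, ← kappa_kosTensor, huy, map_sub, show kappa f y' = 0 from hy'.2, sub_zero]

theorem exists_mem_L_kosTensor_eq (f : Module.Basis (Fin n) R F) (ψ : F →ₗ[R] R)
    (hK : ∀ T, KoszulExact f ψ T) (w : Fin n → ℕ) (a d : ℕ)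
    {z : ExteriorAlgebra R F ⊗[R] SymmetricAlgebra R F} (hz : z ∈ L f w (a + 1) d)
    (hz0 : kosTensor ψ z = 0) : ∃ u ∈ L f w (a + 2) d, kosTensor ψ u = z := by
  induction d generalizing z with
  | zero => exact ⟨0, zero_mem _, by rw [map_zero, eq_zero_of_mem_L_zero f hz]⟩
  | succ d ih =>
    have hκ := kappa_homotopy_of_mem_L f (by omega) hz
    have hy := homotopy_mem_restricted f hz.1
    -- Because `κ (h z) = z` and `Kos z = 0`, anticommutation puts `Kos (h z)` in the kernel of `κ`,
    -- one symmetric degree lower.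
    obtain ⟨y', hy', h⟩ := ih (z := kosTensor ψ (homotopy f z))
      ⟨kosTensor_mem_restricted f ψ w _ _ hy, by
        change kappa f _ = 0
        rw [kappa_kosTensor, hκ, hz0, neg_zero]⟩ (kosTensor_kosTensor _ _)
    obtain ⟨u, hu, huz⟩ := exists_kosTensor_eq_of_kappa f ψ hK hy hy' h
    exact ⟨u, hu, huz.trans hκ⟩

theorem exists_mem_L_kosTensor_eq_of_symEval (f : Module.Basis (Fin n) R F) (ψ : F →ₗ[R] R)
    (hK : ∀ T, KoszulExact f ψ T) (w : Fin n → ℕ) (d : ℕ)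
    {z : ExteriorAlgebra R F ⊗[R] SymmetricAlgebra R F} (hz : z ∈ L f w 0 d)
    (hz0 : symEval ψ z = 0) : ∃ u ∈ L f w 1 d, kosTensor ψ u = z := by
  induction d generalizing z with
  | zero => exact ⟨0, zero_mem _, by rw [map_zero, eq_zero_of_symEval_eq_zero f ψ hz.1 hz0]⟩
  | succ d ih =>
    have hκ := kappa_homotopy_of_mem_L f (by omega) hz
    have hy := homotopy_mem_restricted f hz.1
    -- In exterior degree 0 the kernel condition is empty; `symEval_kappa` carries the vanishing of
    -- the evaluation from `z = κ (h z)` to `Kos (h z)`.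
    obtain ⟨y', hy', h⟩ := ih (z := kosTensor ψ (homotopy f z))
      (by rw [L_zero]; exact kosTensor_mem_restricted f ψ w _ _ hy)
      (by rw [← symEval_kappa f, hκ, hz0])
    obtain ⟨u, hu, huz⟩ := exists_kosTensor_eq_of_kappa f ψ hK hy hy' h
    exact ⟨u, hu, huz.trans hκ⟩

/-! ### A basis of `Lᵃ_{b,w}` -/

/-- The indices `(s, α)` in `indexSet w a b` such that the smallest index that occurs in
`f_s ⊗ f^α` is not in `s`. -/
def goodSet (w : Fin n → ℕ) (a b : ℕ) : Set (Finset (Fin n) × (Fin n → ℕ)) :=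
  {p | p ∈ indexSet w a b ∧ ∀ v, IsPivot (tdeg p) v → v ∉ p.1}

theorem mem_goodSet {w : Fin n → ℕ} {a b : ℕ} {p : Finset (Fin n) × (Fin n → ℕ)} :
    p ∈ goodSet w a b ↔ p ∈ indexSet w a b ∧ ∀ v, IsPivot (tdeg p) v → v ∉ p.1 := Iff.rfl

instance instFintypeGoodSet (w : Fin n → ℕ) (a b : ℕ) : Fintype (goodSet w a b) :=
  ((indexSet_finite w a b).subset fun _ hp => hp.1).fintype

/-- For `a ≥ n` the exterior factor would have to use every index, including the smallest one that
occurs. -/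
theorem goodSet_isEmpty {w : Fin n → ℕ} {a b : ℕ} (ha : n ≤ a) (hb : b ≠ 0) :
    IsEmpty (goodSet w a b) := by
  refine ⟨fun ⟨p, hp, hv⟩ => ?_⟩
  obtain ⟨v, h⟩ := exists_isPivot (tdeg_ne_zero_of_mem_indexSet (by omega) hp)
  refine hv v h ?_
  have : p.1 = Finset.univ := by
    rw [← Finset.card_eq_iff_eq_univ, Fintype.card_fin]
    exact le_antisymm (card_finset_fin_le _) (hp.1 ▸ ha)
  simp [this]

/-- The homotopy outputs only basis elements whose exterior factor contains the pivot. -/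
theorem repr_homotopy_of_mem_goodSet (f : Module.Basis (Fin n) R F) {w : Fin n → ℕ} {a b : ℕ}
    {q : Finset (Fin n) × (Fin n → ℕ)} (hq : q ∈ goodSet w a b)
    (z : ExteriorAlgebra R F ⊗[R] SymmetricAlgebra R F) :
    (tensorBasis f).repr (homotopy f z) q = 0 := by
  have key : (tensorBasis f).coord q ∘ₗ homotopy f = 0 := by
    refine (tensorBasis f).ext fun p => ?_
    rw [LinearMap.comp_apply, LinearMap.zero_apply]
    by_cases h0 : tdeg p = 0
    · rw [homotopy_of_tdeg_eq_zero f h0, map_zero]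
    obtain ⟨v, hv⟩ := exists_isPivot h0
    by_cases hvp : v ∈ p.1
    · rw [homotopy_of_mem f hv hvp, map_zero]
    · rw [homotopy_of_notMem f hv hvp, Module.Basis.coord_apply, Module.Basis.repr_self,
        Finsupp.single_apply, if_neg]
      rintro rfl
      exact hq.2 v (by rwa [tdeg_insert hv hvp]) (Finset.mem_insert_self _ _)
  exact LinearMap.congr_fun key z

/-- Basis elements outside `goodSet` have their pivot in the exterior factor and are killed by the
homotopy. -/
theorem homotopy_eq_sum_goodSet (f : Module.Basis (Fin n) R F) {w : Fin n → ℕ} {a b : ℕ}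
    (hab : a + b ≠ 0) {z : ExteriorAlgebra R F ⊗[R] SymmetricAlgebra R F}
    (hz : z ∈ restricted f w a b) :
    homotopy f z = ∑ p : goodSet w a b,
      (tensorBasis f).repr z p • homotopy f (tensorBasis f p) := by
  have := restricted_le_comap f (homotopy f - ∑ p : goodSet w a b,
    ((tensorBasis f).coord p).smulRight (homotopy f (tensorBasis f p))) ⊥ (fun q hq => ?_) hz
  · rw [Submodule.mem_comap, Submodule.mem_bot, LinearMap.sub_apply, sub_eq_zero] at this
    simpa using this
  · rw [Submodule.mem_bot, LinearMap.sub_apply, sub_eq_zero]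
    simp only [LinearMap.sum_apply, LinearMap.smulRight_apply, Module.Basis.coord_apply,
      Module.Basis.repr_self, Finsupp.single_apply]
    by_cases hg : q ∈ goodSet w a b
    · rw [Finset.sum_eq_single ⟨q, hg⟩]
      · simp
      · rintro ⟨p, hp⟩ _ hne
        rw [if_neg (fun e => hne (Subtype.ext e.symm)), zero_smul]
      · simp
    · obtain ⟨v, hv⟩ := exists_isPivot (tdeg_ne_zero_of_mem_indexSet hab hq)
      rw [homotopy_of_mem f hv, Finset.sum_eq_zero]
      · rintro ⟨p, hp⟩ _
        rw [if_neg (fun e => hg (by rwa [e])), zero_smul]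
      · by_contra hvq
        exact hg ⟨hq, fun v' hv' => hv'.unique hv ▸ hvq⟩

theorem kappa_homotopy_mem_L (f : Module.Basis (Fin n) R F) {w : Fin n → ℕ} {a b : ℕ}
    (hb : 1 ≤ b) {z : ExteriorAlgebra R F ⊗[R] SymmetricAlgebra R F}
    (hz : z ∈ restricted f w a b) : kappa f (homotopy f z) ∈ L f w a b := by
  obtain ⟨b, rfl⟩ : ∃ c, b = c + 1 := ⟨b - 1, by omega⟩
  exact kappa_mem_L f (homotopy_mem_restricted f hz)

/-- Elements of `Lᵃ_{b,w}` are determined by their coordinates in `goodSet w a b`, which can be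
prescribed. -/
def goodCoords (f : Module.Basis (Fin n) R F) (w : Fin n → ℕ) (a b : ℕ) (hb : 1 ≤ b) :
    L f w a b ≃ₗ[R] (goodSet w a b → R) where
  toFun z p := (tensorBasis f).repr z p
  map_add' x y := by ext p; simp
  map_smul' c x := by ext p; simp
  -- `κ h` is the identity on `L` and depends only on the good coordinates, so applying it to the
  -- prescribed coordinates gives the inverse.
  invFun c := ∑ p, c p • ⟨kappa f (homotopy f (tensorBasis f p)),
    kappa_homotopy_mem_L f hb (tensorBasis_mem_restricted f (mem_goodSet.1 p.2).1)⟩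
  left_inv z := by
    ext
    rw [AddSubmonoidClass.coe_finsetSum]
    simp only [Submodule.coe_smul]
    conv_rhs => rw [← kappa_homotopy_of_mem_L f (by omega) z.2,
      homotopy_eq_sum_goodSet f (by omega) z.2.1, map_sum]
    simp only [map_smul]
  right_inv c := by
    ext q
    dsimp only
    rw [AddSubmonoidClass.coe_finsetSum]
    simp only [Submodule.coe_smul, map_sum, map_smul, Finsupp.coe_finsetSum, Finset.sum_apply,
      Finsupp.smul_apply, smul_eq_mul]
    -- Here `κ h` differs from the identity by `h κ`, whose values have no good coordinates.
    have key : ∀ p : goodSet w a b, (tensorBasis f).repr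
        (kappa f (homotopy f (tensorBasis f p))) q = if p = q then 1 else 0 := by
      intro p
      have h := congrArg (fun z => (tensorBasis f).repr z q) (kappa_homotopy_add f
        (tdeg_ne_zero_of_mem_indexSet (a := a) (b := b) (by omega) (mem_goodSet.1 p.2).1))
      simp only [map_add, Finsupp.add_apply, repr_homotopy_of_mem_goodSet f q.2, add_zero,
        Module.Basis.repr_self, Finsupp.single_apply] at h
      rw [h]
      simp [Subtype.ext_iff]
    simp [key]

/-- The basis of `Lᵃ_{b,w}` formed by the `κ (f_v f_s ⊗ f_v⁻¹ f^α)`, where `(s, α)` runs through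
`goodSet w a b` and `v` is the smallest index that occurs in `f_s ⊗ f^α`. -/
def LBasis (f : Module.Basis (Fin n) R F) (w : Fin n → ℕ) (a b : ℕ) (hb : 1 ≤ b) :
    Module.Basis (goodSet w a b) R (L f w a b) :=
  Module.Basis.ofEquivFun (goodCoords f w a b hb)

theorem LBasis_repr (f : Module.Basis (Fin n) R F) (w : Fin n → ℕ) (a b : ℕ) (hb : 1 ≤ b)
    (z : L f w a b) (p : goodSet w a b) :
    (LBasis f w a b hb).repr z p = (tensorBasis f).repr z p := by
  rw [LBasis, Module.Basis.ofEquivFun_repr_apply]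
  rfl

theorem coe_LBasis (f : Module.Basis (Fin n) R F) (w : Fin n → ℕ) (a b : ℕ) (hb : 1 ≤ b)
    (p : goodSet w a b) :
    (LBasis f w a b hb p : ExteriorAlgebra R F ⊗[R] SymmetricAlgebra R F) =
      kappa f (homotopy f (tensorBasis f p)) := by
  have h := kappa_homotopy_mem_L f hb (tensorBasis_mem_restricted f (mem_goodSet.1 p.2).1)
  suffices LBasis f w a b hb p = ⟨_, h⟩ by rw [this]
  rw [LBasis, Module.Basis.coe_ofEquivFun, goodCoords]
  change ∑ q, (Pi.single p 1 : goodSet w a b → R) q • _ = _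
  rw [Finset.sum_eq_single p]
  · simp
  · intro q _ hq
    rw [Pi.single_eq_of_ne hq, zero_smul]
  · simp

/-! ### Homogeneity -/

section Graded

/-- The degree of `f_s ⊗ f^α` if `f i` has degree `e i`. -/
def wdeg (e : Fin n → ℤ) (p : Finset (Fin n) × (Fin n → ℕ)) : ℤ :=
  ∑ i, e i * tdeg p i

/-- The homogeneous elements of degree `k` of `⋀ F ⊗ S F`, if `f i` has degree `e i`. -/
def homogeneous (𝒜 : ℤ → AddSubgroup R) (f : Module.Basis (Fin n) R F) (e : Fin n → ℤ) (k : ℤ) :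
    AddSubgroup (ExteriorAlgebra R F ⊗[R] SymmetricAlgebra R F) where
  carrier := {z | ∀ p, (tensorBasis f).repr z p ∈ 𝒜 (k - wdeg e p)}
  add_mem' hx hy p := by
    rw [map_add, Finsupp.add_apply]
    exact add_mem (hx p) (hy p)
  zero_mem' p := by simp
  neg_mem' hx p := by
    rw [map_neg, Finsupp.neg_apply]
    exact neg_mem (hx p)

variable {𝒜 : ℤ → AddSubgroup R} {f : Module.Basis (Fin n) R F} {e : Fin n → ℤ}

theorem smul_tensorBasis_mem_homogeneous {j k : ℤ} {c : R} (hc : c ∈ 𝒜 j)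
    {p : Finset (Fin n) × (Fin n → ℕ)} (h : j + wdeg e p = k) :
    c • tensorBasis f p ∈ homogeneous 𝒜 f e k := by
  intro q
  rw [map_smul, Module.Basis.repr_self, Finsupp.smul_apply, Finsupp.single_apply]
  split_ifs with hpq
  · subst hpq
    rwa [← h, add_sub_cancel_right, smul_eq_mul, mul_one]
  · simp

variable [GradedRing 𝒜]

theorem map_mem_homogeneous
    {g : ExteriorAlgebra R F ⊗[R] SymmetricAlgebra R F →ₗ[R]
      ExteriorAlgebra R F ⊗[R] SymmetricAlgebra R F}
    (hg : ∀ p, g (tensorBasis f p) ∈ homogeneous 𝒜 f e (wdeg e p)) {k : ℤ}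
    {z : ExteriorAlgebra R F ⊗[R] SymmetricAlgebra R F} (hz : z ∈ homogeneous 𝒜 f e k) :
    g z ∈ homogeneous 𝒜 f e k := by
  rw [← (tensorBasis f).linearCombination_repr z, Finsupp.linearCombination_apply, Finsupp.sum,
    map_sum]
  refine sum_mem fun p _ q => ?_
  rw [map_smul, map_smul, Finsupp.smul_apply, smul_eq_mul,
    show k - wdeg e q = (k - wdeg e p) + (wdeg e p - wdeg e q) by ring]
  exact SetLike.mul_mem_graded (hz p) (hg p q)

theorem sgn_mem_zero (i : Fin n) (s : Finset (Fin n)) : sgn R i s ∈ 𝒜 0 := by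
  simpa using sgn_mul_mem 𝒜 0 (SetLike.one_mem_graded 𝒜) i s

theorem kappa_mem_homogeneous {k : ℤ} {z : ExteriorAlgebra R F ⊗[R] SymmetricAlgebra R F}
    (hz : z ∈ homogeneous 𝒜 f e k) : kappa f z ∈ homogeneous 𝒜 f e k := by
  refine map_mem_homogeneous (fun ⟨s, α⟩ => ?_) hz
  rw [kappa_tensorBasis]
  refine sum_mem fun i hi => smul_tensorBasis_mem_homogeneous (sgn_mem_zero i s) ?_
  rw [zero_add, wdeg, tdeg_erase hi, wdeg]

theorem homotopy_mem_homogeneous {k : ℤ} {z : ExteriorAlgebra R F ⊗[R] SymmetricAlgebra R F}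
    (hz : z ∈ homogeneous 𝒜 f e k) : homotopy f z ∈ homogeneous 𝒜 f e k := by
  refine map_mem_homogeneous (fun p => ?_) hz
  by_cases h0 : tdeg p = 0
  · rw [homotopy_of_tdeg_eq_zero f h0]
    exact zero_mem _
  obtain ⟨v, hv⟩ := exists_isPivot h0
  by_cases hvp : v ∈ p.1
  · rw [homotopy_of_mem f hv hvp]
    exact zero_mem _
  · rw [homotopy_of_notMem f hv hvp, ← one_smul R (tensorBasis f _)]
    refine smul_tensorBasis_mem_homogeneous (SetLike.one_mem_graded 𝒜) ?_
    rw [zero_add, wdeg, tdeg_insert hv hvp, wdeg]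

/-- Deleting `f_i` lowers the degree by `e i`, exactly the degree of the coefficient `ψ(f_i)` that
`Kos` introduces. -/
theorem wdeg_erase (e : Fin n → ℤ) {s : Finset (Fin n)} (α : Fin n → ℕ) {i : Fin n} (hi : i ∈ s) :
    e i + wdeg e (s.erase i, α) = wdeg e (s, α) := by
  have h : ∀ j, (tdeg (s, α) j : ℤ) = tdeg (s.erase i, α) j + if j = i then 1 else 0 := by
    intro j
    by_cases hj : j = i
    · subst hj; simp [tdeg, hi, add_comm]
    · simp [tdeg, hj]
  simp [wdeg, h, mul_add, Finset.sum_add_distrib, add_comm]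

theorem kosTensor_mem_homogeneous {ψ : F →ₗ[R] R} (he : ∀ i, ψ (f i) ∈ 𝒜 (e i)) {k : ℤ}
    {z : ExteriorAlgebra R F ⊗[R] SymmetricAlgebra R F}
    (hz : z ∈ homogeneous 𝒜 f e k) : kosTensor ψ z ∈ homogeneous 𝒜 f e k := by
  refine map_mem_homogeneous (fun ⟨s, α⟩ => ?_) hz
  rw [kosTensor_tensorBasis]
  exact sum_mem fun i hi => smul_tensorBasis_mem_homogeneous (sgn_mul_mem 𝒜 _ (he i) i s)
    (wdeg_erase e α hi)

theorem symEval_mem_of_mem_homogeneous {ψ : F →ₗ[R] R} (he : ∀ i, ψ (f i) ∈ 𝒜 (e i)) {k : ℤ}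
    {w : Fin n → ℕ} {b : ℕ} {z : ExteriorAlgebra R F ⊗[R] SymmetricAlgebra R F}
    (hz : z ∈ homogeneous 𝒜 f e k) (hz' : z ∈ restricted f w 0 b) : symEval ψ z ∈ 𝒜 k := by
  rw [← (tensorBasis f).linearCombination_repr z, Finsupp.linearCombination_apply, Finsupp.sum,
    map_sum]
  refine sum_mem fun ⟨s, α⟩ hp => ?_
  obtain ⟨h1, -, -⟩ := (mem_restricted_iff f).1 hz' _ (Finsupp.mem_support_iff.1 hp)
  obtain rfl : s = ∅ := Finset.card_eq_zero.1 h1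
  rw [map_smul, symEval_tensorBasis_empty, smul_eq_mul,
    show k = (k - wdeg e (∅, α)) + wdeg e (∅, α) by ring]
  refine SetLike.mul_mem_graded (hz _) ?_
  rw [show wdeg e (∅, α) = ∑ i, α i • e i by simp [wdeg, tdeg, mul_comm]]
  exact SetLike.prod_mem_graded _ _ _ fun i _ => SetLike.pow_mem_graded _ (he i)

theorem LBasis_mem_homogeneous (w : Fin n → ℕ) (a b : ℕ) (hb : 1 ≤ b) (p : goodSet w a b) :
    (LBasis f w a b hb p : ExteriorAlgebra R F ⊗[R] SymmetricAlgebra R F) ∈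
      homogeneous 𝒜 f e (wdeg e p) := by
  rw [coe_LBasis]
  refine kappa_mem_homogeneous (homotopy_mem_homogeneous ?_)
  rw [← one_smul R (tensorBasis f _)]
  exact smul_tensorBasis_mem_homogeneous (SetLike.one_mem_graded 𝒜) (zero_add _)

end Graded

/-! ### The resolution -/

/-- The rank of the `i`th term of `L^w(ψ, d)`. -/
def termRank (w : Fin n → ℕ) (d : ℕ) : ℕ → ℕ
  | 0 => 1
  | a + 1 => Fintype.card (goodSet w a d)

/-- A basis of the `i`th term of `L^w(ψ, d)`. -/
def termBasis (f : Module.Basis (Fin n) R F) (w : Fin n → ℕ) (d : ℕ) (hd : 1 ≤ d) :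
    ∀ i, Module.Basis (Fin (termRank w d i)) R (Term f w d i)
  | 0 => Module.Basis.singleton (Fin 1) R
  | a + 1 => (LBasis f w a d hd).reindex (Fintype.equivFin (goodSet w a d))

/-- The degrees of the elements of `termBasis`, if `f i` has degree `e i`. -/
def termDegree (e : Fin n → ℤ) (w : Fin n → ℕ) (d : ℕ) : ∀ i, Fin (termRank w d i) → ℤ
  | 0 => fun _ => 0
  | a + 1 => fun j => wdeg e ((Fintype.equivFin (goodSet w a d)).symm j)

theorem subsingleton_term (f : Module.Basis (Fin n) R F) (w : Fin n → ℕ) {d : ℕ} (hd : 1 ≤ d)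
    {i : ℕ} (hi : n < i) : Subsingleton (Term f w d i) := by
  -- Term `i` is `L^{i-1}`, so `n < i` means exterior degree at least `n`.
  obtain ⟨a, rfl⟩ : ∃ a, i = a + 1 := ⟨i - 1, by omega⟩
  have := goodSet_isEmpty (w := w) (a := a) (b := d) (by omega) (by omega)
  exact (goodCoords f w a d hd).toEquiv.subsingleton

theorem exact_diff (f : Module.Basis (Fin n) R F) (ψ : F →ₗ[R] R) (hK : ∀ T, KoszulExact f ψ T)
    (w : Fin n → ℕ) (d : ℕ) (i : ℕ) :
    Function.Exact (diff f ψ w d (i + 1)) (diff f ψ w d i) := by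
  cases i with
  | zero =>
    rintro (z : L f w 0 d)
    constructor
    · intro hz
      obtain ⟨u, hu, huz⟩ := exists_mem_L_kosTensor_eq_of_symEval f ψ hK w d z.2 hz
      exact ⟨(⟨u, hu⟩ : L f w 1 d), Subtype.ext huz⟩
    · rintro ⟨u, rfl⟩
      exact symEval_kosTensor ψ f (Subtype.prop (u : L f w 1 d))
  | succ a =>
    rintro (z : L f w (a + 1) d)
    constructor
    · intro hz
      obtain ⟨u, hu, huz⟩ := exists_mem_L_kosTensor_eq f ψ hK w a d z.2 (congrArg Subtype.val hz)
      exact ⟨(⟨u, hu⟩ : L f w (a + 2) d), Subtype.ext huz⟩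
    · rintro ⟨u, rfl⟩
      exact Subtype.ext (kosTensor_kosTensor ψ (Subtype.val (u : L f w (a + 2) d)))

theorem map_symEval_L_zero (f : Module.Basis (Fin n) R F) (ψ : F →ₗ[R] R) (w : Fin n → ℕ) (d : ℕ) :
    (L f w 0 d).map (symEval ψ) = restrictedPower (fun i => ψ (f i)) w d := by
  rw [L_zero, restricted_eq_span, Submodule.map_span, restrictedPower, Ideal.span]
  congr 1
  ext y
  simp only [Set.mem_image, exists_exists_and_eq_and]
  constructor
  · rintro ⟨⟨s, α⟩, ⟨hs, hα, hw⟩, rfl⟩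
    obtain rfl : s = ∅ := Finset.card_eq_zero.1 hs
    exact ⟨α, fun i => by simpa [tdeg] using hw i, hα, symEval_tensorBasis_empty ψ f α⟩
  · rintro ⟨α, hw, hα, rfl⟩
    exact ⟨(∅, α), ⟨rfl, hα, fun i => by simpa [tdeg] using hw i⟩,
      symEval_tensorBasis_empty ψ f α⟩

theorem exact_diff_zero (f : Module.Basis (Fin n) R F) (ψ : F →ₗ[R] R) (w : Fin n → ℕ) (d : ℕ) :
    Function.Exact (diff f ψ w d 0) (restrictedPower (fun i => ψ (f i)) w d).mkQ := by
  rintro (x : R)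
  have h : (restrictedPower (fun i => ψ (f i)) w d).mkQ x = 0 ↔
      x ∈ (L f w 0 d).map (symEval ψ) := by
    rw [Submodule.mkQ_apply, Submodule.Quotient.mk_eq_zero, ← map_symEval_L_zero]
  refine h.trans ⟨?_, ?_⟩
  · rintro ⟨z, hz, rfl⟩
    exact ⟨(⟨z, hz⟩ : L f w 0 d), rfl⟩
  · rintro ⟨z, rfl⟩
    exact ⟨_, Subtype.prop (z : L f w 0 d), rfl⟩

theorem restrictedPower_le {x : Fin n → R} {m : Ideal R} (hx : ∀ i, x i ∈ m) (w : Fin n → ℕ)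
    {d : ℕ} (hd : 1 ≤ d) : restrictedPower x w d ≤ m := by
  rw [restrictedPower, Ideal.span_le]
  rintro _ ⟨α, -, hα, rfl⟩
  obtain ⟨i, -, hi⟩ := Finset.exists_ne_zero_of_sum_ne_zero (s := Finset.univ) (f := α) (by omega)
  exact Ideal.mem_of_dvd _ (Finset.dvd_prod_of_mem _ (Finset.mem_univ i))
    (Ideal.pow_mem_of_mem m (hx i) _ (Nat.pos_of_ne_zero hi))

theorem kosTensor_eq_sum (f : Module.Basis (Fin n) R F) (ψ : F →ₗ[R] R)
    (z : ExteriorAlgebra R F ⊗[R] SymmetricAlgebra R F) :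
    kosTensor ψ z = ∑ i, ψ (f i) • kosTensor (f.coord i) z := by
  induction z with
  | zero => simp
  | add x y hx hy => simp only [map_add, hx, hy, smul_add, Finset.sum_add_distrib]
  | tmul x s =>
    simp only [kosTensor, TensorProduct.map_tmul, LinearMap.id_apply]
    rw [kos_eq_sum f ψ x, TensorProduct.sum_tmul]
    simp only [TensorProduct.smul_tmul']

/-- Each contraction with `fᵢ*` maps `Lᵃ⁺¹` into `Lᵃ`, so expanding `Kos` lands in `m Lᵃ` itself,
not merely in `m (⋀ F ⊗ S F) ∩ Lᵃ`. At the last map, `d ≥ 1` puts every generator of the restricted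
power in `m`. -/
theorem range_diff_le (f : Module.Basis (Fin n) R F) (ψ : F →ₗ[R] R) {m : Ideal R}
    (hm : ∀ i, ψ (f i) ∈ m) (w : Fin n → ℕ) {d : ℕ} (hd : 1 ≤ d) (i : ℕ) :
    LinearMap.range (diff f ψ w d i) ≤ m • (⊤ : Submodule R (Term f w d i)) := by
  cases i with
  | zero =>
    rintro _ ⟨z, rfl⟩
    have h : symEval ψ (Subtype.val (z : L f w 0 d)) ∈ m :=
      restrictedPower_le hm w hd (map_symEval_L_zero f ψ w d ▸
        Submodule.mem_map_of_mem (Subtype.prop (z : L f w 0 d)))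
    have h2 : symEval ψ (Subtype.val (z : L f w 0 d)) ∈ m • (⊤ : Submodule R R) := by
      rwa [smul_eq_mul, Ideal.mul_top]
    exact h2
  | succ a =>
    rintro _ ⟨z, rfl⟩
    let z' : L f w (a + 1) d := z
    have h : diff f ψ w d (a + 1) z = ∑ i, ψ (f i) • (⟨kosTensor (f.coord i) z',
        kosTensor_mem_L f (f.coord i) w a d z'.2⟩ : L f w a d) := by
      refine Subtype.ext ?_
      rw [AddSubmonoidClass.coe_finsetSum]
      exact kosTensor_eq_sum f ψ z'
    rw [h]
    exact Submodule.sum_mem _ fun i _ => Submodule.smul_mem_smul (hm i) Submodule.mem_top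

theorem isMinimalFreeResolution_diff (f : Module.Basis (Fin n) R F) (ψ : F →ₗ[R] R)
    (hK : ∀ T, KoszulExact f ψ T) {m : Ideal R} (hm : ∀ i, ψ (f i) ∈ m) (w : Fin n → ℕ) {d : ℕ}
    (hd : 1 ≤ d) :
    IsMinimalFreeResolution m (diff f ψ w d) (M := R ⧸ restrictedPower (fun i => ψ (f i)) w d)
      (restrictedPower (fun i => ψ (f i)) w d).mkQ where
  free i := Module.Free.of_basis (termBasis f w d hd i)
  finite i := Module.Finite.of_basis (termBasis f w d hd i)
  exact := exact_diff f ψ hK w d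
  exact_zero := exact_diff_zero f ψ w d
  surjective := Submodule.mkQ_surjective (restrictedPower (fun i => ψ (f i)) w d)
  minimal := range_diff_le f ψ hm w hd

/-- Coordinates in `LBasis` are the ambient coordinates at good indices, so homogeneity of the
matrix entries can be read off in `⋀ F ⊗ S F`. The generator of `R` gets degree 0. -/
theorem isGradedComplex_diff {𝒜 : ℤ → AddSubgroup R} [GradedRing 𝒜] (f : Module.Basis (Fin n) R F)
    (ψ : F →ₗ[R] R) {e : Fin n → ℤ} (he : ∀ i, ψ (f i) ∈ 𝒜 (e i)) (w : Fin n → ℕ) {d : ℕ}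
    (hd : 1 ≤ d) :
    IsGradedComplex 𝒜 (diff f ψ w d) (J := restrictedPower (fun i => ψ (f i)) w d)
      (restrictedPower (fun i => ψ (f i)) w d).mkQ := by
  refine ⟨termRank w d, termBasis f w d hd, termDegree e w d, fun i j k => ?_, fun k => ?_⟩
  · have hj : (termBasis f w d hd (i + 1) j : L f w i d) =
        LBasis f w i d hd ((Fintype.equivFin (goodSet w i d)).symm j) :=
      (LBasis f w i d hd).reindex_apply (Fintype.equivFin (goodSet w i d)) j
    have hom := LBasis_mem_homogeneous (𝒜 := 𝒜) (f := f) (e := e) w i d hd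
      ((Fintype.equivFin (goodSet w i d)).symm j)
    rw [← hj] at hom
    cases i with
    | zero =>
      have h := symEval_mem_of_mem_homogeneous he hom
        (Subtype.prop (termBasis f w d hd 1 j : L f w 0 d)).1
      have hr : (termBasis f w d hd 0).repr (diff f ψ w d 0 (termBasis f w d hd 1 j)) k =
          symEval ψ (termBasis f w d hd 1 j : L f w 0 d).val :=
        Module.Basis.singleton_repr (Fin 1) R _ _
      have hk : termDegree e w d 1 j - termDegree e w d 0 k = termDegree e w d 1 j := sub_zero _
      rw [hr, hk]
      exact h
    | succ a =>
      have h := kosTensor_mem_homogeneous he hom ((Fintype.equivFin (goodSet w a d)).symm k)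
      have hr : (termBasis f w d hd (a + 1)).repr
          (diff f ψ w d (a + 1) (termBasis f w d hd (a + 2) j)) k =
          (tensorBasis f).repr (kosTensor ψ
            (termBasis f w d hd (a + 2) j : L f w (a + 1) d).val)
            ((Fintype.equivFin (goodSet w a d)).symm k) := by
        refine (Module.Basis.repr_reindex_apply _ _ _ _).trans ?_
        exact LBasis_repr f w a d hd _ _
      rw [hr]
      exact h
  · refine ⟨1, SetLike.one_mem_graded 𝒜, ?_⟩
    have : termBasis f w d hd 0 k = (1 : R) := Module.Basis.singleton_apply (Fin 1) R k
    rw [this]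
    rfl

end

end LComplex

theorem theorem3 {R : Type u} [CommRing R] {F : Type u} [AddCommGroup F] [Module R F] {n : ℕ}
    (f : Module.Basis (Fin n) R F) (ψ : F →ₗ[R] R)
    (hreg : RingTheory.Sequence.IsRegular R (List.ofFn fun i => ψ (f i)))
    (w : Fin n → ℕ) (d : ℕ) (hd : 1 ≤ d) :
    -- the terms `Lᵃ` with `a ≥ n` vanish: the complex is `0 → Lⁿ⁻¹ → ⋯ → L¹ → (S_d)_w → R`
    (∀ i, n < i → Subsingleton (LComplex.Term f w d i)) ∧
    -- the local case
    (∀ [IsNoetherianRing R] [IsLocalRing R],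
      LComplex.IsMinimalFreeResolution (IsLocalRing.maximalIdeal R) (LComplex.diff f ψ w d)
        (M := R ⧸ LComplex.restrictedPower (fun i => ψ (f i)) w d)
        (LComplex.restrictedPower (fun i => ψ (f i)) w d).mkQ) ∧
    -- the graded case
    (∀ (𝒜 : ℤ → AddSubgroup R) [GradedRing 𝒜],
      (∀ i < 0, 𝒜 i = ⊥) → (∀ i, ∃ e > 0, ψ (f i) ∈ 𝒜 e) →
      LComplex.IsMinimalFreeResolution (Ideal.span {x | ∃ e > 0, x ∈ 𝒜 e}) (LComplex.diff f ψ w d)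
        (M := R ⧸ LComplex.restrictedPower (fun i => ψ (f i)) w d)
        (LComplex.restrictedPower (fun i => ψ (f i)) w d).mkQ ∧
      LComplex.IsGradedComplex 𝒜 (LComplex.diff f ψ w d)
        (J := LComplex.restrictedPower (fun i => ψ (f i)) w d)
        (LComplex.restrictedPower (fun i => ψ (f i)) w d).mkQ) := by
  have huniv := LComplex.KoszulExact.univ_of_isWeaklyRegular f ψ hreg.toIsWeaklyRegular
  refine ⟨fun i hi => LComplex.subsingleton_term f w hd hi, ?_, ?_⟩
  · intro _ _
    -- A regular sequence generates a proper ideal, so none of its members is a unit.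
    have hm : ∀ i, ψ (f i) ∈ IsLocalRing.maximalIdeal R := by
      intro i
      rw [IsLocalRing.mem_maximalIdeal]
      intro hu
      refine hreg.top_ne_smul ?_
      rw [smul_eq_mul, Ideal.mul_top, eq_comm]
      exact Ideal.eq_top_of_isUnit_mem _ (Ideal.subset_span (List.mem_ofFn.2 ⟨i, rfl⟩)) hu
    exact LComplex.isMinimalFreeResolution_diff f ψ (LComplex.KoszulExact.of_univ huniv
      fun t T ht h => h.of_insert_of_isLocalRing ht (hm t)) hm w hd
  · intro 𝒜 _ h𝒜 hψ
    choose e hpos he using hψ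
    exact ⟨LComplex.isMinimalFreeResolution_diff f ψ (LComplex.KoszulExact.of_univ huniv
      fun t T ht h => h.of_insert_of_graded h𝒜 hpos he ht)
      (fun i => Ideal.subset_span (show ∃ e > 0, ψ (f i) ∈ 𝒜 e from ⟨e i, hpos i, he i⟩)) w hd,
      LComplex.isGradedComplex_diff f ψ he w hd⟩
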